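/- Let $K$ be a field. A special poset is a finite set $P$ with a partial order $\leq_1$ and a total order $\leq_2$; up to isomorphism, $P=\{1,\ldots,n\}$ and $\leq_2$ is the usual order. Let $\mathbf{h}_{SP}$ be the $K$-vector space with basis the isomorphism classes of special posets. It is a Hopf algebra for the following product and coproduct. The product $PQ$ of two special posets is the disjoint union of $P$ and $Q$, where both orders are kept on $P$ and on $Q$, and where, for $x\in P$ and $y\in Q$, $x$ and $y$ are incomparable for $\leq_1$ and $x\leq_2 y$. The coproduct is $$\Delta(P)=\sum_{I}(P\setminus I)\otimes I,$$ where $I$ runs over the subsets of $P$ such that $x\in I$ and $x\leq_1 y$ imply $y\in I$. The unit is the empty poset, and the counit sends the empty poset to $1$ and every nonempty one to $0$. A plane poset is a finite set $P$ with two partial orders $\leq_h,\leq_r$ such that any two distinct elements are comparable for $\leq_h$ if, and only if, they are not comparable for $\leq_r$. Then the relation "$x\leq y$ if, and only if, $x\leq_h y$ or $x\leq_r y$" is a total order on $P$, and $(P,\leq_h,\leq)$ is a special poset; the special posets obtained in this way are called special plane posets. The subspace $\mathbf{h}_{SPP}$ of $\mathbf{h}_{SP}$ that they span is a Hopf subalgebra.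 Let $\mathbf{FQSym}$ be the $K$-vector space with basis the disjoint union of the symmetric groups $\mathfrak{S}_n$, $n\geq 0$. It is a Hopf algebra for the following product and coproduct. For $\sigma\in\mathfrak{S}_k$ and $\tau\in\mathfrak{S}_l$, $$\sigma\tau=\sum_{\epsilon}(\sigma\otimes\tau)\circ\epsilon,$$ where $\epsilon$ runs over the permutations in $\mathfrak{S}_{k+l}$ such that $\epsilon^{-1}(1)<\cdots<\epsilon^{-1}(k)$ and $\epsilon^{-1}(k+1)<\cdots<\epsilon^{-1}(k+l)$, and where $\sigma\otimes\tau\in\mathfrak{S}_{k+l}$ acts as $\sigma$ on $\{1,\ldots,k\}$ and as $\tau$, shifted by $k$, on $\{k+1,\ldots,k+l\}$. For $\sigma\in\mathfrak{S}_n$, $$\Delta(\sigma)=\sum_{k=0}^n \sigma_1^{(k)}\otimes\sigma_2^{(k)},$$ where $\sigma_1^{(k)}\in\mathfrak{S}_k$ and $\sigma_2^{(k)}\in\mathfrak{S}_{n-k}$ are the standardizations of the words $\sigma(1)\cdots\sigma(k)$ and $\sigma(k+1)\cdots\sigma(n)$. The unit is the element of $\mathfrak{S}_0$, and the counit sends it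 to $1$ and the permutations in $\mathfrak{S}_n$, $n\geq 1$, to $0$. For a special poset $P=\{1,\ldots,n\}$ ($\leq_2$ being the usual order), a linear extension of $P$ is a permutation $\sigma\in\mathfrak{S}_n$ such that, for all $i\neq j$, $i\leq_1 j$ implies $\sigma^{-1}(i)<\sigma^{-1}(j)$. Let $\Theta:\mathbf{h}_{SP}\to\mathbf{FQSym}$ be the linear map that sends every special poset $P$ to the sum of its linear extensions. Then the restriction of $\Theta$ to $\mathbf{h}_{SPP}$ is an isomorphism of Hopf algebras $\mathbf{h}_{SPP}\cong\mathbf{FQSym}$. -/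

import Mathlib

open scoped TensorProduct

noncomputable section

/-- A partial order on `α`, as a term (so that a type can carry several of them). -/
@[ext]
structure POrder (α : Type*) where
  le : α → α → Prop
  refl : ∀ a, le a a
  trans : ∀ a b c, le a b → le b c → le a c
  antisymm : ∀ a b, le a b → le b a → a = b

namespace POrder

/-- Pull back along an injective map. -/
def comap {α β : Type*} (r : POrder β) (f : α ↪ β) : POrder α where
  le a b := r.le (f a) (f b)
  refl _ := r.refl _
  trans _ _ _ := r.trans _ _ _
  antisymm _ _ h h' := f.injective (r.antisymm _ _ h h')

/-- The restriction to a subset. -/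
def res {α : Type*} (r : POrder α) (S : Finset α) : POrder S :=
  r.comap (Function.Embedding.subtype _)

/-- The disjoint union of two partial orders: no element of `α` is comparable with an element
of `β`. The type `α ⊕ₗ β` is the disjoint union in which every element of `α` comes before every
element of `β`. -/
def sum {α β : Type*} (r : POrder α) (s : POrder β) : POrder (α ⊕ₗ β) where
  le x y := match ofLex x, ofLex y with
    | .inl a, .inl b => r.le a b
    | .inr a, .inr b => s.le a b
    | _, _ => False
  refl x := by
    rcases x with a | a
    exacts [r.refl a, s.refl a]
  trans x y z := by
    rcases x with a | a <;> rcases y with b | b <;> rcases z with c | c <;>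
      first
      | exact r.trans a b c
      | exact s.trans a b c
      | exact fun h _ => False.elim h
      | exact fun _ h => False.elim h
  antisymm x y := by
    rcases x with a | a <;> rcases y with b | b
    exacts [fun h h' => congrArg Sum.inl (r.antisymm _ _ h h'), fun h => False.elim h, fun h => False.elim h,
      fun h h' => congrArg Sum.inr (s.antisymm _ _ h h')]

/-- Ideals: subsets that are closed upwards. -/
def IsIdeal {α : Type*} (r : POrder α) (I : Finset α) : Prop :=
  ∀ x ∈ I, ∀ y, r.le x y → y ∈ I

end POrder

/-- A special double poset, up to isomorphism: its second order being total, the ground set is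
identified with `{0, ..., n - 1}` with its usual order, and `ord` is the first order. -/
structure SpecialPoset where
  n : ℕ
  ord : POrder (Fin n)

namespace SpecialPoset

/-- The isomorphism class of a finite set `α` with a first order `r` and a total second order. -/
def std {α : Type*} [Fintype α] [LinearOrder α] (r : POrder α) : SpecialPoset :=
  ⟨Fintype.card α, r.comap (monoEquivOfFin α rfl).toEquiv.toEmbedding⟩

theorem eq_of_iso (P Q : SpecialPoset) (e : Fin P.n ≃o Fin Q.n)
    (h : ∀ i j, P.ord.le i j ↔ Q.ord.le (e i) (e j)) : P = Q := by
  obtain ⟨n, r⟩ := P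
  obtain ⟨m, s⟩ := Q
  obtain rfl : n = m := by simpa using Fintype.card_congr e.toEquiv
  obtain rfl : e = OrderIso.refl _ := Subsingleton.elim _ _
  congr 1
  apply POrder.ext
  ext i j
  exact h i j

theorem std_congr {α β : Type*} [Fintype α] [LinearOrder α] [Fintype β] [LinearOrder β]
    {r : POrder α} {s : POrder β} (e : α ≃o β)
    (h : ∀ a b, r.le a b ↔ s.le (e a) (e b)) : std r = std s := by
  refine eq_of_iso _ _ (((monoEquivOfFin α rfl).trans e).trans (monoEquivOfFin β rfl).symm) ?_
  intro i j
  refine (h _ _).trans ?_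
  change s.le _ _ ↔ s.le (monoEquivOfFin β rfl ((monoEquivOfFin β rfl).symm _))
    (monoEquivOfFin β rfl ((monoEquivOfFin β rfl).symm _))
  rw [OrderIso.apply_symm_apply, OrderIso.apply_symm_apply]
  rfl

theorem std_congr' {α β : Type*} [Fintype α] [LinearOrder α] [Fintype β] [LinearOrder β]
    {r : POrder α} {s : POrder β} (f : α → β) (hf : StrictMono f) (hs : Function.Surjective f)
    (h : ∀ a b, r.le a b ↔ s.le (f a) (f b)) : std r = std s :=
  std_congr (hf.orderIsoOfSurjective f hs) h

/-- Two finite sets with a first order and a total second order give the same special poset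
exactly when they are isomorphic as double posets. -/
theorem std_eq_iff {α β : Type*} [Fintype α] [LinearOrder α] [Fintype β] [LinearOrder β]
    {r : POrder α} {s : POrder β} :
    std r = std s ↔ ∃ e : α ≃o β, ∀ a b, r.le a b ↔ s.le (e a) (e b) := by
  refine ⟨fun h => ?_, fun ⟨e, h⟩ => std_congr e h⟩
  have key : ∀ P Q : SpecialPoset, P = Q →
      ∃ e : Fin P.n ≃o Fin Q.n, ∀ i j, P.ord.le i j ↔ Q.ord.le (e i) (e j) := by
    rintro P _ rfl
    exact ⟨OrderIso.refl _, fun _ _ => Iff.rfl⟩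
  obtain ⟨e, he⟩ := key _ _ h
  refine ⟨((monoEquivOfFin α rfl).symm.trans e).trans (monoEquivOfFin β rfl), fun a b => ?_⟩
  have := he ((monoEquivOfFin α rfl).symm a) ((monoEquivOfFin α rfl).symm b)
  change r.le (monoEquivOfFin α rfl _) (monoEquivOfFin α rfl _) ↔ _ at this
  rw [OrderIso.apply_symm_apply, OrderIso.apply_symm_apply] at this
  exact this

theorem std_ord (P : SpecialPoset) : std P.ord = P :=
  eq_of_iso _ _ (monoEquivOfFin (Fin P.n) rfl) fun _ _ => Iff.rfl

/-- The double subposet with underlying set `S`. -/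
def sub {α : Type*} [LinearOrder α] (r : POrder α) (S : Finset α) : SpecialPoset :=
  std (r.res S)

/-- The composition `PQ` of special posets: the disjoint union, where `x ≤₂ y` and `x, y` are
incomparable for `≤₁`, for all `x` in `P` and `y` in `Q`. -/
instance : Mul SpecialPoset :=
  ⟨fun P Q => std (P.ord.sum Q.ord)⟩

/-- The empty special poset. -/
instance : One SpecialPoset := ⟨std (α := Fin 0) ⟨fun _ _ => True, by simp, by simp, by simp⟩⟩

theorem std_mul_std {α β : Type*} [Fintype α] [LinearOrder α] [Fintype β] [LinearOrder β]
    (r : POrder α) (s : POrder β) : std r * std s = std (r.sum s) := by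
  refine std_congr (OrderIso.sumLexCongr (monoEquivOfFin α rfl) (monoEquivOfFin β rfl)) ?_
  rintro (a | a) (b | b) <;> exact Iff.rfl

theorem std_eq_one {α : Type*} [Fintype α] [LinearOrder α] [IsEmpty α] (r : POrder α) :
    std r = 1 :=
  std_congr ⟨Equiv.equivOfIsEmpty _ _, fun {a} => isEmptyElim a⟩ fun a => isEmptyElim a

theorem std_sum_empty {α β : Type*} [Fintype α] [LinearOrder α] [Fintype β] [LinearOrder β]
    [IsEmpty β] (r : POrder α) (s : POrder β) : std (r.sum s) = std r := by
  refine (std_congr' (fun a => toLex (Sum.inl a)) Sum.Lex.inl_strictMono ?_ fun _ _ => Iff.rfl).symm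
  rintro (a | a)
  exacts [⟨a, rfl⟩, isEmptyElim a]

theorem std_empty_sum {α β : Type*} [Fintype α] [LinearOrder α] [Fintype β] [LinearOrder β]
    [IsEmpty α] (r : POrder α) (s : POrder β) : std (r.sum s) = std s := by
  refine (std_congr' (fun a => toLex (Sum.inr a)) Sum.Lex.inr_strictMono ?_ fun _ _ => Iff.rfl).symm
  rintro (a | a)
  exacts [isEmptyElim a, ⟨a, rfl⟩]

instance : Monoid SpecialPoset where
  mul_assoc P Q R := by
    rw [← std_ord P, ← std_ord Q, ← std_ord R, std_mul_std, std_mul_std, std_mul_std, std_mul_std]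
    refine std_congr (OrderIso.sumLexAssoc _ _ _) ?_
    rintro ((a | a) | a) ((b | b) | b) <;> exact Iff.rfl
  one_mul P := by
    nth_rw 1 [← std_ord P]
    exact (std_mul_std _ _).trans ((std_empty_sum _ _).trans P.std_ord)
  mul_one P := by
    nth_rw 1 [← std_ord P]
    exact (std_mul_std _ _).trans ((std_sum_empty _ _).trans P.std_ord)

end SpecialPoset
namespace ConnectedBialgebra

variable {K H : Type*} [Field K] [Ring H] [Bialgebra K H]

open WithConv Coalgebra

/-- A filtration of a bialgebra compatible with the coproduct, with trivial degree zero part. -/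
structure IsConnectedFiltration (F : ℕ → Submodule K H) : Prop where
  mono : Monotone F
  exhaust : ∀ x, ∃ n, x ∈ F n
  zero : ∀ x ∈ F 0, x = algebraMap K H (counit x)
  comul_mem : ∀ n, ∀ x ∈ F n, comul (R := K) x ∈
    Submodule.span K {t | ∃ i j, i + j = n ∧ ∃ a ∈ F i, ∃ b ∈ F j, t = a ⊗ₜ[K] b}

variable (K H) in
/-- The difference of the convolution unit and the identity. -/
def dev : WithConv (H →ₗ[K] H) := 1 - toConv LinearMap.id

theorem conv_eq_of_agree {F : ℕ → Submodule K H} (hF : IsConnectedFiltration F)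
    {f f' g g' : WithConv (H →ₗ[K] H)} {n : ℕ} {x : H} (hx : x ∈ F n)
    (h : ∀ i j, i + j = n → ∀ a ∈ F i, ∀ b ∈ F j, f a * g b = f' a * g' b) :
    (f * g) x = (f' * g') x := by
  rw [LinearMap.convMul_apply, LinearMap.convMul_apply]
  have := hF.comul_mem n x hx
  generalize (comul x : H ⊗[K] H) = t at this
  induction this using Submodule.span_induction with
  | mem t ht =>
    obtain ⟨i, j, hij, a, ha, b, hb, rfl⟩ := ht
    simpa using h i j hij a ha b hb
  | zero => simp
  | add t u _ _ ht hu => simp only [map_add, ht, hu]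
  | smul c t _ ht => simp only [map_smul, ht]

theorem dev_pow_apply {F : ℕ → Submodule K H} (hF : IsConnectedFiltration F) (k n : ℕ)
    (hk : n < k) (x : H) (hx : x ∈ F n) : (dev K H ^ k) x = 0 := by
  have h0 : ∀ a ∈ F 0, dev K H a = 0 := fun a ha => by
    change algebraMap K H (counit a) - a = 0
    rw [← hF.zero a ha, sub_self]
  induction k generalizing n x with
  | zero => omega
  | succ k ih =>
    rw [pow_succ']
    have : (dev K H * dev K H ^ k) x = ((0 : WithConv (H →ₗ[K] H)) * 0) x := by
      refine conv_eq_of_agree hF hx fun i j hij a ha b hb => ?_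
      rcases Nat.eq_zero_or_pos i with rfl | hi
      · rw [h0 a ha, zero_mul]; exact (zero_mul _).symm
      · rw [ih j (by omega) b hb, mul_zero]; exact (zero_mul _).symm
    rw [this, zero_mul]
    rfl

/-- The truncated geometric series. -/
def geom (n : ℕ) : WithConv (H →ₗ[K] H) := ∑ k ∈ Finset.range (n + 1), dev K H ^ k

theorem geom_apply {F : ℕ → Submodule K H} (hF : IsConnectedFiltration F) {m n : ℕ}
    (hmn : m ≤ n) {x : H} (hx : x ∈ F m) : geom (K := K) n x = geom (K := K) m x := by
  induction n, hmn using Nat.le_induction with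
  | base => rfl
  | succ n hmn ih =>
    rw [← ih, geom, Finset.sum_range_succ, ← geom]
    change geom n x + (dev K H ^ (n + 1)) x = _
    rw [dev_pow_apply hF _ _ (by omega) x hx, add_zero]

/-- The antipode of a connected bialgebra: the geometric series of `ηε - id` for convolution. -/
def antipode {F : ℕ → Submodule K H} (hF : IsConnectedFiltration F) : H →ₗ[K] H where
  toFun x := geom (K := K) (hF.exhaust x).choose x
  map_add' x y := by
    set n := max (hF.exhaust (x + y)).choose
      (max (hF.exhaust x).choose (hF.exhaust y).choose)
    rw [← geom_apply hF (n := n) (by simp [n]) (hF.exhaust (x + y)).choose_spec,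
      ← geom_apply hF (n := n) (by simp [n]) (hF.exhaust x).choose_spec,
      ← geom_apply hF (n := n) (by simp [n]) (hF.exhaust y).choose_spec]
    exact map_add (geom n).ofConv x y
  map_smul' c x := by
    set n := max (hF.exhaust (c • x)).choose (hF.exhaust x).choose
    rw [← geom_apply hF (n := n) (by simp [n]) (hF.exhaust (c • x)).choose_spec,
      ← geom_apply hF (n := n) (by simp [n]) (hF.exhaust x).choose_spec]
    exact map_smul (geom n).ofConv c x

theorem antipode_apply {F : ℕ → Submodule K H} (hF : IsConnectedFiltration F) {n : ℕ} {x : H}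
    (hx : x ∈ F n) : antipode hF x = geom (K := K) n x := by
  rcases le_total n (hF.exhaust x).choose with h | h
  · exact geom_apply hF h hx
  · exact (geom_apply hF h (hF.exhaust x).choose_spec).symm

/-- A connected filtered bialgebra is a Hopf algebra. -/
@[reducible]
def hopf {F : ℕ → Submodule K H} (hF : IsConnectedFiltration F) : HopfAlgebra K H where
  antipode := antipode hF
  mul_antipode_rTensor_comul := by
    ext x
    obtain ⟨n, hx⟩ := hF.exhaust x
    have h : (toConv (antipode hF) * toConv LinearMap.id : WithConv (H →ₗ[K] H)) x =
        (geom n * toConv LinearMap.id : WithConv (H →ₗ[K] H)) x :=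
      conv_eq_of_agree hF hx fun i j hij a ha b _ => by
        congr 1
        exact (antipode_apply hF (hF.mono (by omega : i ≤ n) ha))
    have h' : (geom n * toConv LinearMap.id : WithConv (H →ₗ[K] H)) = 1 - dev K H ^ (n + 1) := by
      rw [← geom_sum_mul_neg, geom]; simp [dev]
    rw [h'] at h
    refine h.trans ?_
    change algebraMap K H (counit x) - (dev K H ^ (n + 1)) x = _
    rw [dev_pow_apply hF _ _ n.lt_succ_self x hx, sub_zero]
    rfl
  mul_antipode_lTensor_comul := by
    ext x
    obtain ⟨n, hx⟩ := hF.exhaust x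
    have h : (toConv LinearMap.id * toConv (antipode hF) : WithConv (H →ₗ[K] H)) x =
        (toConv LinearMap.id * geom n : WithConv (H →ₗ[K] H)) x :=
      conv_eq_of_agree hF hx fun i j hij a _ b hb => by
        congr 1
        exact (antipode_apply hF (hF.mono (by omega : j ≤ n) hb))
    have h' : (toConv LinearMap.id * geom n : WithConv (H →ₗ[K] H)) = 1 - dev K H ^ (n + 1) := by
      rw [← mul_neg_geom_sum, geom]; simp [dev]
    rw [h'] at h
    refine h.trans ?_
    change algebraMap K H (counit x) - (dev K H ^ (n + 1)) x = _
    rw [dev_pow_apply hF _ _ n.lt_succ_self x hx, sub_zero]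
    rfl

/-- The filtration given by a spanning family of homogeneous elements. -/
theorem isConnectedFiltration_of_span {ι : Type*} (b : ι → H) (deg : ι → ℕ)
    (hb : Submodule.span K (Set.range b) = ⊤)
    (h₀ : ∀ i, deg i = 0 → b i = algebraMap K H (counit (b i)))
    (hΔ : ∀ i, comul (R := K) (b i) ∈
      Submodule.span K {t | ∃ j k, deg j + deg k = deg i ∧ t = b j ⊗ₜ[K] b k}) :
    IsConnectedFiltration (K := K) fun n => Submodule.span K (b '' {i | deg i ≤ n}) where
  mono m n h := Submodule.span_mono (Set.image_mono fun i hi => le_trans hi h)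
  exhaust x := by
    have hx : x ∈ Submodule.span K (Set.range b) := hb ▸ Submodule.mem_top
    induction hx using Submodule.span_induction with
    | mem x hx =>
      obtain ⟨i, rfl⟩ := hx
      exact ⟨deg i, Submodule.subset_span ⟨i, le_refl (deg i), rfl⟩⟩
    | zero => exact ⟨0, zero_mem _⟩
    | add x y _ _ hx hy =>
      obtain ⟨m, hm⟩ := hx
      obtain ⟨n, hn⟩ := hy
      exact ⟨max m n, add_mem
        (Submodule.span_mono (Set.image_mono fun i hi => le_trans hi (le_max_left m n)) hm)
        (Submodule.span_mono (Set.image_mono fun i hi => le_trans hi (le_max_right m n)) hn)⟩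
    | smul c x _ hx =>
      obtain ⟨m, hm⟩ := hx
      exact ⟨m, Submodule.smul_mem _ _ hm⟩
  zero x hx := by
    induction hx using Submodule.span_induction with
    | mem x hx =>
      obtain ⟨i, hi, rfl⟩ := hx
      exact h₀ i (Nat.le_zero.1 hi)
    | zero => simp
    | add x y _ _ hx hy => rw [map_add, map_add, ← hx, ← hy]
    | smul c x _ hx => rw [map_smul, smul_eq_mul, map_mul, ← hx, Algebra.smul_def]
  comul_mem n x hx := by
    induction hx using Submodule.span_induction with
    | mem x hx =>
      obtain ⟨i, hi, rfl⟩ := hx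
      refine Submodule.span_mono ?_ (hΔ i)
      rintro t ⟨j, k, hjk, rfl⟩
      have hi : deg i ≤ n := hi
      refine ⟨deg j, n - deg j, by omega, b j, Submodule.subset_span ⟨j, le_refl (deg j), rfl⟩, b k,
        Submodule.subset_span ⟨k, ?_, rfl⟩, rfl⟩
      change deg k ≤ n - deg j
      omega
    | zero => simp
    | add x y _ _ hx hy => rw [map_add]; exact add_mem hx hy
    | smul c x _ hx => rw [map_smul]; exact Submodule.smul_mem _ _ hx

end ConnectedBialgebra

/-- The Hopf algebra of special posets: the vector space with basis the set of (isomorphism classes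
of) special posets, with the product extending the composition. -/
def HSP (K : Type*) [Field K] : Type _ := MonoidAlgebra K SpecialPoset

namespace HSP

open SpecialPoset

variable (K : Type*) [Field K]

instance : Ring (HSP K) := inferInstanceAs (Ring (MonoidAlgebra K SpecialPoset))
instance : Algebra K (HSP K) := inferInstanceAs (Algebra K (MonoidAlgebra K SpecialPoset))

/-- The basis of special posets. -/
def basis : Module.Basis SpecialPoset K (HSP K) := MonoidAlgebra.basis SpecialPoset K

/-- A special poset, as an element of `HSP K`. -/
abbrev of (P : SpecialPoset) : HSP K := basis K P

theorem basis_eq (P : SpecialPoset) : of K P = MonoidAlgebra.of K SpecialPoset P :=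
  MonoidAlgebra.basis_apply _ _

theorem of_mul (P Q : SpecialPoset) : of K (P * Q) = of K P * of K Q := by
  rw [basis_eq, basis_eq, basis_eq]
  exact map_mul (MonoidAlgebra.of K SpecialPoset) P Q

theorem of_one : of K 1 = 1 := by
  rw [basis_eq]
  exact map_one (MonoidAlgebra.of K SpecialPoset)

open scoped Classical in
/-- The coproduct `∑ (P \ I) ⊗ I`, over the ideals `I`, of a special poset with first order `r`. -/
def copr {α : Type*} [Fintype α] [LinearOrder α] (r : POrder α) : HSP K ⊗[K] HSP K :=
  ∑ I : Finset α with r.IsIdeal I, of K (sub r Iᶜ) ⊗ₜ of K (sub r I)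

instance : CoalgebraStruct K (HSP K) where
  comul := (basis K).constr K fun P => copr K P.ord
  counit := (basis K).constr K fun P => if P.n = 0 then 1 else 0

theorem comul_of (P : SpecialPoset) : Coalgebra.comul (R := K) (of K P) = copr K P.ord :=
  (basis K).constr_basis K _ _

theorem counit_of (P : SpecialPoset) :
    Coalgebra.counit (R := K) (of K P) = if P.n = 0 then 1 else 0 :=
  (basis K).constr_basis K _ _

theorem sub_congr {α β : Type*} [LinearOrder α] [LinearOrder β] {r : POrder α} {s : POrder β}
    (f : α ↪o β) (h : ∀ a b, r.le a b ↔ s.le (f a) (f b)) (S : Finset α) (T : Finset β)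
    (hT : T = S.map f.toEmbedding) : sub r S = sub s T := by
  refine std_congr' (fun a => ⟨f a, by simp [hT]⟩) ?_ ?_ ?_
  · intro a b hab
    simpa using hab
  · rintro ⟨b, hb⟩
    rw [hT] at hb
    simp only [Finset.mem_map] at hb
    obtain ⟨a, ha, rfl⟩ := hb
    exact ⟨⟨a, ha⟩, rfl⟩
  · intro a b
    exact h _ _

theorem sub_univ {α : Type*} [Fintype α] [LinearOrder α] (r : POrder α) :
    sub r Finset.univ = std r :=
  std_congr' Subtype.val (fun _ _ h => h) (fun a => ⟨⟨a, Finset.mem_univ a⟩, rfl⟩)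
    fun _ _ => Iff.rfl

theorem sub_empty {α : Type*} [LinearOrder α] (r : POrder α) : sub r ∅ = 1 :=
  std_eq_one _

open scoped Classical in
/-- The coproduct of a double subposet. -/
theorem copr_res {α : Type*} [LinearOrder α] (r : POrder α) (S : Finset α) :
    copr K (r.res S) = ∑ J ∈ S.powerset with (∀ x ∈ J, ∀ y ∈ S, r.le x y → y ∈ J),
      of K (sub r (S \ J)) ⊗ₜ of K (sub r J) := by
  classical
  unfold copr
  have key : ∀ (I : Finset S) (J : Finset α), J = I.map (.subtype _) →
      (sub (r.res S) Iᶜ = sub r (S \ J) ∧ sub (r.res S) I = sub r J) := by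
    rintro I J rfl
    constructor
    · refine sub_congr (OrderEmbedding.subtype _) (fun _ _ => Iff.rfl) _ _ ?_
      ext x
      by_cases hx : x ∈ S <;> simp [hx]
    · exact sub_congr (OrderEmbedding.subtype _) (fun _ _ => Iff.rfl) _ _ rfl
  refine Finset.sum_bij' (fun I _ => I.map (.subtype _)) (fun J _ => J.subtype (· ∈ S))
    ?_ ?_ ?_ ?_ ?_
  · intro I hI
    simp only [Finset.mem_filter_univ] at hI
    simp only [Finset.mem_filter, Finset.mem_powerset]
    constructor
    · intro x hx
      simp at hx
      exact hx.1
    · intro x hx y hy hxy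
      simp only [Finset.mem_map, Function.Embedding.subtype_apply] at hx ⊢
      obtain ⟨a, ha, rfl⟩ := hx
      exact ⟨⟨y, hy⟩, hI a ha _ hxy, rfl⟩
  · intro J hJ
    simp only [Finset.mem_filter, Finset.mem_powerset] at hJ
    simp only [Finset.mem_filter_univ]
    intro x hx y hxy
    simp only [Finset.mem_subtype] at hx ⊢
    exact hJ.2 _ hx _ y.2 hxy
  · intro I _
    ext x
    simp
  · intro J hJ
    simp only [Finset.mem_filter, Finset.mem_powerset] at hJ
    rw [Finset.subtype_map, Finset.filter_true_of_mem hJ.1]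
  · intro I _
    rw [← (key I _ rfl).1, ← (key I _ rfl).2]
    congr!

theorem copr_congr {α β : Type*} [Fintype α] [LinearOrder α] [Fintype β] [LinearOrder β]
    {r : POrder α} {s : POrder β} (e : α ≃o β) (h : ∀ a b, r.le a b ↔ s.le (e a) (e b)) :
    copr K r = copr K s := by
  classical
  unfold copr
  refine Finset.sum_equiv e.toEquiv.finsetCongr ?_ ?_
  · intro I
    simp only [Finset.mem_filter_univ]
    simp [POrder.IsIdeal, h, e.surjective.forall]
  · intro I _
    congr 2
    · refine sub_congr e.toOrderEmbedding h _ _ ?_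
      ext x
      obtain ⟨x, rfl⟩ := e.surjective x
      simp
    · exact sub_congr e.toOrderEmbedding h _ _ rfl

theorem comul_std {α : Type*} [Fintype α] [LinearOrder α] (r : POrder α) :
    Coalgebra.comul (R := K) (of K (std r)) = copr K r :=
  (comul_of K _).trans (copr_congr K (monoEquivOfFin α rfl) fun _ _ => Iff.rfl)

open scoped Classical in
theorem counit_std {α : Type*} [Fintype α] [LinearOrder α] (r : POrder α) :
    Coalgebra.counit (R := K) (of K (std r)) = if IsEmpty α then 1 else 0 := by
  simp [counit_of, std, Fintype.card_eq_zero_iff]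

theorem counit_sub {α : Type*} [LinearOrder α] (r : POrder α) (S : Finset α) :
    Coalgebra.counit (R := K) (of K (sub r S)) = if S = ∅ then 1 else 0 := by
  simp [sub, counit_std, Finset.isEmpty_coe_sort]

theorem coassoc_copr {α : Type*} [Fintype α] [LinearOrder α] (r : POrder α) :
    TensorProduct.assoc K _ _ _ (Coalgebra.comul.rTensor _ (copr K r)) =
      Coalgebra.comul.lTensor _ (copr K r) := by
  classical
  have h : ∀ S : Finset α, Coalgebra.comul (R := K) (of K (sub r S)) =
      ∑ J ∈ S.powerset with (∀ x ∈ J, ∀ y ∈ S, r.le x y → y ∈ J),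
        of K (sub r (S \ J)) ⊗ₜ of K (sub r J) := by
    intro S
    rw [sub, comul_std, copr_res]
    congr!
  conv_lhs => unfold copr
  conv_rhs => unfold copr
  simp only [map_sum, LinearMap.rTensor_tmul, LinearMap.lTensor_tmul, h,
    TensorProduct.sum_tmul, TensorProduct.tmul_sum, TensorProduct.assoc_tmul]
  rw [Finset.sum_sigma', Finset.sum_sigma']
  refine Finset.sum_bij' (fun x _ => ⟨x.2 ∪ x.1, x.1⟩) (fun x _ => ⟨x.2, x.1 \ x.2⟩) ?_ ?_ ?_ ?_ ?_
  · rintro ⟨I, J⟩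
    simp only [Finset.mem_sigma, Finset.mem_filter_univ, Finset.mem_filter, Finset.mem_powerset]
    grind [POrder.IsIdeal, Finset.mem_compl]
  · rintro ⟨I, J⟩
    simp only [Finset.mem_sigma, Finset.mem_filter_univ, Finset.mem_filter, Finset.mem_powerset]
    grind [POrder.IsIdeal, Finset.mem_compl]
  · rintro ⟨I, J⟩
    simp only [Finset.mem_sigma, Finset.mem_filter_univ, Finset.mem_filter, Finset.mem_powerset,
      Sigma.mk.injEq, heq_eq_eq]
    grind [POrder.IsIdeal, Finset.mem_compl]
  · rintro ⟨I, J⟩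
    simp only [Finset.mem_sigma, Finset.mem_filter_univ, Finset.mem_filter, Finset.mem_powerset,
      Sigma.mk.injEq, heq_eq_eq]
    grind [POrder.IsIdeal, Finset.mem_compl]
  · rintro ⟨I, J⟩
    simp only [Finset.mem_sigma, Finset.mem_filter_univ, Finset.mem_filter, Finset.mem_powerset]
    intro hIJ
    have e₁ : Iᶜ \ J = (J ∪ I)ᶜ := by grind [Finset.mem_compl]
    have e₂ : (J ∪ I) \ I = J := by grind [Finset.mem_compl]
    simp only [e₁, e₂]

instance : Coalgebra K (HSP K) where
  coassoc := (basis K).ext fun P => by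
    simpa [comul_of] using coassoc_copr K P.ord
  rTensor_counit_comp_comul := (basis K).ext fun P => by
    classical
    simp only [LinearMap.comp_apply, comul_of, copr, map_sum, LinearMap.rTensor_tmul, counit_sub]
    rw [Finset.sum_eq_single_of_mem Finset.univ]
    · simp [sub_univ, std_ord]
    · simp only [Finset.mem_filter_univ]; simp [POrder.IsIdeal]
    · intro I _ hI
      rw [if_neg (by simpa using hI), TensorProduct.zero_tmul]
  lTensor_counit_comp_comul := (basis K).ext fun P => by
    classical
    simp only [LinearMap.comp_apply, comul_of, copr, map_sum, LinearMap.lTensor_tmul, counit_sub]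
    rw [Finset.sum_eq_single_of_mem ∅]
    · simp [sub_univ, std_ord]
    · simp only [Finset.mem_filter_univ]; simp [POrder.IsIdeal]
    · intro I _ hI
      rw [if_neg hI, TensorProduct.tmul_zero]

/-- The disjoint union of two subsets. -/
def lsum {α β : Type*} (I : Finset α) (J : Finset β) : Finset (α ⊕ₗ β) :=
  (I.disjSum J).map toLex.toEmbedding

theorem inl_mem_lsum {α β : Type*} {I : Finset α} {J : Finset β} {a : α} :
    toLex (Sum.inl a) ∈ lsum I J ↔ a ∈ I := by
  simp [lsum]

theorem inr_mem_lsum {α β : Type*} {I : Finset α} {J : Finset β} {a : β} :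
    toLex (Sum.inr a) ∈ lsum I J ↔ a ∈ J := by
  simp [lsum]

theorem lex_forall {α β : Type*} {p : α ⊕ₗ β → Prop} :
    (∀ x, p x) ↔ (∀ a, p (toLex (.inl a))) ∧ ∀ b, p (toLex (.inr b)) :=
  ⟨fun h => ⟨fun _ => h _, fun _ => h _⟩, fun h x => by
    rcases x with a | a
    exacts [h.1 a, h.2 a]⟩

theorem sub_lsum {α β : Type*} [LinearOrder α] [LinearOrder β]
    (r : POrder α) (s : POrder β) (I : Finset α) (J : Finset β) :
    sub (r.sum s) (lsum I J) = sub r I * sub s J := by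
  rw [sub, sub, sub, std_mul_std]
  let f : (I ⊕ₗ J : Type _) → (lsum I J : Finset (α ⊕ₗ β)) :=
    fun x => match ofLex x with
    | .inl a => ⟨toLex (.inl a.1), inl_mem_lsum.2 a.2⟩
    | .inr a => ⟨toLex (.inr a.1), inr_mem_lsum.2 a.2⟩
  refine (std_congr' f ?_ ?_ ?_).symm
  · simp only [StrictMono, lex_forall]
    refine ⟨fun a => ⟨fun b h => ?_, fun b h => ?_⟩, fun a => ⟨fun b h => ?_, fun b h => ?_⟩⟩
    · exact Sum.Lex.inl_lt_inl_iff.2 (Subtype.coe_lt_coe.2 (Sum.Lex.inl_lt_inl_iff.1 h))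
    · exact Sum.Lex.inl_lt_inr _ _
    · exact absurd h Sum.Lex.not_inr_lt_inl
    · exact Sum.Lex.inr_lt_inr_iff.2 (Subtype.coe_lt_coe.2 (Sum.Lex.inr_lt_inr_iff.1 h))
  · simp only [Function.Surjective, Subtype.forall, lex_forall]
    exact ⟨fun a ha => ⟨toLex (.inl ⟨a, inl_mem_lsum.1 ha⟩), rfl⟩,
      fun a ha => ⟨toLex (.inr ⟨a, inr_mem_lsum.1 ha⟩), rfl⟩⟩
  · rintro (a | a) (b | b) <;> exact Iff.rfl

theorem copr_sum {α β : Type*} [Fintype α] [LinearOrder α] [Fintype β] [LinearOrder β]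
    (r : POrder α) (s : POrder β) : copr K (r.sum s) = copr K r * copr K s := by
  classical
  simp only [copr, Finset.sum_mul_sum, Algebra.TensorProduct.tmul_mul_tmul, ← of_mul]
  rw [← Finset.sum_product']
  symm
  refine Finset.sum_bij' (fun x _ => lsum x.1 x.2)
    (fun T _ => (Finset.univ.filter fun a => toLex (Sum.inl a) ∈ T,
      Finset.univ.filter fun a => toLex (Sum.inr a) ∈ T)) ?_ ?_ ?_ ?_ ?_
  · rintro ⟨I, J⟩
    simp only [Finset.mem_product, Finset.mem_filter_univ]
    simp only [POrder.IsIdeal, lex_forall, inl_mem_lsum, inr_mem_lsum]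
    exact fun h => ⟨fun a ha => ⟨h.1 a ha, fun _ h => False.elim h⟩,
      fun a ha => ⟨fun _ h => False.elim h, h.2 a ha⟩⟩
  · rintro T
    simp only [Finset.mem_product, Finset.mem_filter_univ]
    intro h
    simp only [POrder.IsIdeal, Finset.mem_filter_univ]
    exact ⟨fun a ha b hab => h (toLex (.inl a)) ha (toLex (.inl b)) hab,
      fun a ha b hab => h (toLex (.inr a)) ha (toLex (.inr b)) hab⟩
  · rintro ⟨I, J⟩ _
    simp [inl_mem_lsum, inr_mem_lsum]
  · rintro T _
    simp only [Finset.ext_iff, lex_forall, inl_mem_lsum, inr_mem_lsum]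
    simp
  · rintro ⟨I, J⟩ _
    rw [sub_lsum, ← sub_lsum]
    congr 3
    simp [Finset.ext_iff, lex_forall, inl_mem_lsum, inr_mem_lsum]

theorem comul_of_mul (P Q : SpecialPoset) : Coalgebra.comul (R := K) (of K (P * Q)) =
    Coalgebra.comul (of K P) * Coalgebra.comul (of K Q) := by
  rw [comul_of K P, comul_of K Q, ← copr_sum]
  exact comul_std K _

instance : Bialgebra K (HSP K) where
  counit_one := by
    rw [← of_one, counit_of]
    rfl
  mul_compr₂_counit := (basis K).ext fun P => (basis K).ext fun Q => by
    have h : (P * Q).n = 0 ↔ P.n = 0 ∧ Q.n = 0 := by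
      change Fintype.card (Fin P.n ⊕ₗ Fin Q.n) = 0 ↔ _
      rw [Fintype.card_lex, Fintype.card_sum, Fintype.card_fin, Fintype.card_fin,
        Nat.add_eq_zero_iff]
    simp only [LinearMap.compr₂_apply, LinearMap.mul_apply', LinearMap.compl₁₂_apply, ← of_mul,
      counit_of, h, ite_and, mul_ite, mul_one, mul_zero]
    split_ifs <;> rfl
  comul_one := by
    rw [← of_one]
    refine (comul_std K _).trans ?_
    rw [copr, Finset.sum_eq_single_of_mem ∅]
    · rw [Finset.eq_empty_of_isEmpty ∅ᶜ, sub_empty, of_one]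
      rfl
    · simp only [Finset.mem_filter_univ]
      simp [POrder.IsIdeal]
    · intro I _ hI
      exact absurd (Finset.eq_empty_of_isEmpty I) hI
  mul_compr₂_comul := (basis K).ext fun P => (basis K).ext fun Q => by
    simp [← of_mul, comul_of_mul]

theorem n_sub {α : Type*} [LinearOrder α] (r : POrder α) (S : Finset α) :
    (sub r S).n = S.card :=
  Fintype.card_coe S

theorem eq_one_of_n {P : SpecialPoset} (h : P.n = 0) : P = 1 := by
  obtain ⟨n, r⟩ := P
  obtain rfl : n = 0 := h
  rw [← std_ord ⟨0, r⟩]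
  exact std_eq_one _

instance : HopfAlgebra K (HSP K) :=
  ConnectedBialgebra.hopf (ConnectedBialgebra.isConnectedFiltration_of_span (basis K) n
    (basis K).span_eq
    (fun P hP => by
      obtain rfl := eq_one_of_n hP
      change of K 1 = algebraMap K _ (Coalgebra.counit (of K 1))
      rw [of_one, Bialgebra.counit_one, map_one])
    fun P => by
      rw [comul_of K P, copr]
      refine Submodule.sum_mem _ fun I _ => Submodule.subset_span ⟨_, _, ?_, rfl⟩
      rw [n_sub, n_sub, Finset.card_compl_add_card, Fintype.card_fin])

end HSP

namespace CoalgebraTransfer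

variable {K A B : Type*} [Field K] [AddCommGroup A] [Module K A] [CoalgebraStruct K A]
  [AddCommGroup B] [Module K B] [CoalgebraStruct K B] (f : A →ₗ[K] B)

theorem assoc_rTensor
    (hf : ∀ x, Coalgebra.comul (f x) = TensorProduct.map f f (Coalgebra.comul (R := K) x))
    (t : A ⊗[K] A) :
    TensorProduct.assoc K B B B (Coalgebra.comul.rTensor B (TensorProduct.map f f t)) =
      TensorProduct.map f (TensorProduct.map f f)
        (TensorProduct.assoc K A A A (Coalgebra.comul.rTensor A t)) := by
  induction t using TensorProduct.induction_on with
  | zero => simp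
  | add t u ht hu => simp only [map_add, ht, hu]
  | tmul a b =>
    rw [TensorProduct.map_map_assoc]
    simp [hf]

theorem lTensor_comul
    (hf : ∀ x, Coalgebra.comul (f x) = TensorProduct.map f f (Coalgebra.comul (R := K) x))
    (t : A ⊗[K] A) :
    Coalgebra.comul.lTensor B (TensorProduct.map f f t) =
      TensorProduct.map f (TensorProduct.map f f) (Coalgebra.comul.lTensor A t) := by
  induction t using TensorProduct.induction_on with
  | zero => simp
  | add t u ht hu => simp only [map_add, ht, hu]
  | tmul a b => simp [hf]

theorem rTensor_counit
    (hf : ∀ x, Coalgebra.counit (f x) = Coalgebra.counit (R := K) x) (t : A ⊗[K] A) :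
    Coalgebra.counit.rTensor B (TensorProduct.map f f t) =
      f.lTensor K (Coalgebra.counit.rTensor A t) := by
  induction t using TensorProduct.induction_on with
  | zero => simp
  | add t u ht hu => simp only [map_add, ht, hu]
  | tmul a b => simp [hf]

theorem lTensor_counit
    (hf : ∀ x, Coalgebra.counit (f x) = Coalgebra.counit (R := K) x) (t : A ⊗[K] A) :
    Coalgebra.counit.lTensor B (TensorProduct.map f f t) =
      f.rTensor K (Coalgebra.counit.lTensor A t) := by
  induction t using TensorProduct.induction_on with
  | zero => simp
  | add t u ht hu => simp only [map_add, ht, hu]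
  | tmul a b => simp [hf]

end CoalgebraTransfer

/-- The Hopf algebra of free quasi-symmetric functions: the vector space with basis the disjoint
union of the symmetric groups. -/
def FQSym (K : Type*) [Field K] : Type _ := (Σ n : ℕ, Equiv.Perm (Fin n)) →₀ K

namespace FQSym

variable (K : Type*) [Field K]

instance : AddCommGroup (FQSym K) :=
  inferInstanceAs (AddCommGroup ((Σ n : ℕ, Equiv.Perm (Fin n)) →₀ K))
instance : Module K (FQSym K) := inferInstanceAs (Module K ((Σ n : ℕ, Equiv.Perm (Fin n)) →₀ K))

/-- The basis of permutations. -/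
def basis : Module.Basis (Σ n : ℕ, Equiv.Perm (Fin n)) K (FQSym K) :=
  Module.Basis.ofRepr (LinearEquiv.refl K _)

/-- A permutation, as an element of `FQSym K`. -/
abbrev of {n : ℕ} (σ : Equiv.Perm (Fin n)) : FQSym K := basis K ⟨n, σ⟩

/-- The permutation `σ ⊗ τ` acting as `σ` on the first `k` letters, and as `τ` (shifted by `k`)
on the last `l` letters. -/
def tens {k l : ℕ} (σ : Equiv.Perm (Fin k)) (τ : Equiv.Perm (Fin l)) : Equiv.Perm (Fin (k + l)) :=
  finSumFinEquiv.permCongr (Equiv.Perm.sumCongr σ τ)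

/-- The `(k, l)`-shuffles. -/
def IsShuffle (k l : ℕ) (ε : Equiv.Perm (Fin (k + l))) : Prop :=
  StrictMono (fun i : Fin k => ε⁻¹ (Fin.castAdd l i)) ∧
    StrictMono (fun j : Fin l => ε⁻¹ (Fin.natAdd k j))

/-- The standardization of a word: `std w i < std w j` if, and only if, `w i < w j` (for a word
without repetition). -/
def std {k : ℕ} {α : Type*} [LinearOrder α] (w : Fin k → α) : Equiv.Perm (Fin k) :=
  (Tuple.sort w)⁻¹

open scoped Classical in
/-- The product of two permutations: `∑ (σ ⊗ τ) ∘ ε`, over the `(k, l)`-shuffles `ε`. -/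
def mulPerm {k l : ℕ} (σ : Equiv.Perm (Fin k)) (τ : Equiv.Perm (Fin l)) : FQSym K :=
  ∑ ε : Equiv.Perm (Fin (k + l)) with IsShuffle k l ε, of K (tens σ τ * ε)

/-- The word formed by the first `k` letters of `σ`. -/
def left {n : ℕ} (σ : Equiv.Perm (Fin n)) (k : Fin (n + 1)) (i : Fin k) : Fin n :=
  σ ⟨i, by omega⟩

/-- The word formed by the last `n - k` letters of `σ`. -/
def right {n : ℕ} (σ : Equiv.Perm (Fin n)) (k : Fin (n + 1)) (j : Fin (n - k)) : Fin n :=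
  σ ⟨k + j, by omega⟩

/-- The coproduct of a permutation: cut its word in all possible ways, and standardize. -/
def comulPerm {n : ℕ} (σ : Equiv.Perm (Fin n)) : FQSym K ⊗[K] FQSym K :=
  ∑ k : Fin (n + 1), of K (std (left σ k)) ⊗ₜ of K (std (right σ k))

/-- The product, as a bilinear map. -/
def mulBilin : FQSym K →ₗ[K] FQSym K →ₗ[K] FQSym K :=
  (basis K).constr K fun x => (basis K).constr K fun y => mulPerm K x.2 y.2

instance : Mul (FQSym K) := ⟨fun x y => mulBilin K x y⟩

/-- The unit: the unique permutation of the empty set. -/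
instance : One (FQSym K) := ⟨of K (1 : Equiv.Perm (Fin 0))⟩

instance : CoalgebraStruct K (FQSym K) where
  comul := (basis K).constr K fun x => comulPerm K x.2
  counit := (basis K).constr K fun x => if x.1 = 0 then 1 else 0

theorem of_mul_of {k l : ℕ} (σ : Equiv.Perm (Fin k)) (τ : Equiv.Perm (Fin l)) :
    of K σ * of K τ = mulPerm K σ τ := by
  change mulBilin K _ _ = _
  rw [mulBilin, Module.Basis.constr_basis, Module.Basis.constr_basis]

theorem comul_of {n : ℕ} (σ : Equiv.Perm (Fin n)) :
    Coalgebra.comul (R := K) (of K σ) = comulPerm K σ :=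
  (basis K).constr_basis K _ _

theorem counit_of {n : ℕ} (σ : Equiv.Perm (Fin n)) :
    Coalgebra.counit (R := K) (of K σ) = if n = 0 then 1 else 0 :=
  (basis K).constr_basis K _ _

/-- Linear extensions of a special poset: if `i` is smaller than `j` for the first order, then the
letter `i` comes before the letter `j` in the word representing `σ`. -/
def IsLinExt (P : SpecialPoset) (σ : Equiv.Perm (Fin P.n)) : Prop :=
  ∀ i j, i ≠ j → P.ord.le i j → σ⁻¹ i < σ⁻¹ j

open scoped Classical in
/-- The map sending a special poset to the sum of its linear extensions. -/
def theta : HSP K →ₗ[K] FQSym K :=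
  (HSP.basis K).constr K fun P => ∑ σ : Equiv.Perm (Fin P.n) with IsLinExt P σ, of K σ

open scoped Classical in
theorem theta_of (P : SpecialPoset) :
    theta K (HSP.of K P) = ∑ σ : Equiv.Perm (Fin P.n) with IsLinExt P σ, of K σ :=
  (HSP.basis K).constr_basis K _ _

theorem strictMono_std {k : ℕ} {α : Type*} [LinearOrder α] {w : Fin k → α}
    (hw : Function.Injective w) : StrictMono fun i => w ((std w)⁻¹ i) := by
  rw [std, inv_inv]
  exact (Tuple.monotone_sort w).strictMono_of_injective (hw.comp (Tuple.sort w).injective)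

theorem perm_eq_one {k : ℕ} {σ : Equiv.Perm (Fin k)} (h : StrictMono σ) : σ = 1 := by
  have := Subsingleton.elim (h.orderIsoOfSurjective σ σ.surjective) (OrderIso.refl (Fin k))
  ext i
  exact congrArg (fun e : Fin k ≃o Fin k => (e i : ℕ)) this

theorem perm_unique {k : ℕ} {α : Type*} [LinearOrder α] {w : Fin k → α} {σ τ : Equiv.Perm (Fin k)}
    (hσ : StrictMono fun i => w (σ i)) (hτ : StrictMono fun i => w (τ i)) : σ = τ := by
  have : StrictMono (σ⁻¹ * τ : Equiv.Perm (Fin k)) := by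
    intro i j hij
    have := hτ hij
    rw [← hσ.lt_iff_lt]
    simpa using this
  exact inv_mul_eq_one.1 (perm_eq_one this)

theorem tens_castAdd {k l : ℕ} (σ : Equiv.Perm (Fin k)) (τ : Equiv.Perm (Fin l)) (i : Fin k) :
    tens σ τ (Fin.castAdd l i) = Fin.castAdd l (σ i) := by
  simp [tens, Equiv.permCongr_apply]

theorem tens_natAdd {k l : ℕ} (σ : Equiv.Perm (Fin k)) (τ : Equiv.Perm (Fin l)) (i : Fin l) :
    tens σ τ (Fin.natAdd k i) = Fin.natAdd k (τ i) := by
  simp [tens, Equiv.permCongr_apply]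

theorem tens_inv {k l : ℕ} (σ : Equiv.Perm (Fin k)) (τ : Equiv.Perm (Fin l)) :
    (tens σ τ)⁻¹ = tens σ⁻¹ τ⁻¹ := rfl

/-- The composition, with ground set `{0, ..., k + l - 1}`. -/
def comp (P Q : SpecialPoset) : SpecialPoset :=
  ⟨P.n + Q.n, (P.ord.sum Q.ord).comap (finSumFinEquiv.symm.trans toLex).toEmbedding⟩

theorem mul_eq_comp (P Q : SpecialPoset) : P * Q = comp P Q := by
  rw [← (comp P Q).std_ord]
  refine SpecialPoset.std_congr' (fun x => finSumFinEquiv (ofLex x)) ?_ ?_ ?_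
  · simp only [StrictMono, HSP.lex_forall]
    refine ⟨fun a => ⟨fun b h => ?_, fun b h => ?_⟩, fun a => ⟨fun b h => ?_, fun b h => ?_⟩⟩
    · have h : a < b := Sum.Lex.inl_lt_inl_iff.1 h
      exact h
    · change (a : ℕ) < P.n + b
      omega
    · exact absurd h Sum.Lex.not_inr_lt_inl
    · have h : a < b := Sum.Lex.inr_lt_inr_iff.1 h
      exact Nat.add_lt_add_left h _
  · exact finSumFinEquiv.surjective.comp ofLex.surjective
  · intro a b
    simp [comp, POrder.comap]

theorem isLinExt_comp (P Q : SpecialPoset) (ρ : Equiv.Perm (Fin (P.n + Q.n))) :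
    IsLinExt (comp P Q) ρ ↔
      (∀ i j, i ≠ j → P.ord.le i j → ρ⁻¹ (Fin.castAdd _ i) < ρ⁻¹ (Fin.castAdd _ j)) ∧
      (∀ i j, i ≠ j → Q.ord.le i j → ρ⁻¹ (Fin.natAdd _ i) < ρ⁻¹ (Fin.natAdd _ j)) := by
  have hl : ∀ i j, (comp P Q).ord.le (Fin.castAdd Q.n i) (Fin.castAdd Q.n j) ↔ P.ord.le i j := by
    intro i j
    simp only [comp, POrder.comap, Equiv.coe_toEmbedding, Equiv.trans_apply,
      finSumFinEquiv_symm_apply_castAdd]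
    exact Iff.rfl
  have hr : ∀ i j, (comp P Q).ord.le (Fin.natAdd P.n i) (Fin.natAdd P.n j) ↔ Q.ord.le i j := by
    intro i j
    simp only [comp, POrder.comap, Equiv.coe_toEmbedding, Equiv.trans_apply,
      finSumFinEquiv_symm_apply_natAdd]
    exact Iff.rfl
  have hlr : ∀ i j, ¬ (comp P Q).ord.le (Fin.castAdd Q.n i) (Fin.natAdd P.n j) := by
    intro i j
    simp only [comp, POrder.comap, Equiv.coe_toEmbedding, Equiv.trans_apply,
      finSumFinEquiv_symm_apply_natAdd, finSumFinEquiv_symm_apply_castAdd]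
    exact id
  have hrl : ∀ i j, ¬ (comp P Q).ord.le (Fin.natAdd P.n j) (Fin.castAdd Q.n i) := by
    intro i j
    simp only [comp, POrder.comap, Equiv.coe_toEmbedding, Equiv.trans_apply,
      finSumFinEquiv_symm_apply_natAdd, finSumFinEquiv_symm_apply_castAdd]
    exact id
  constructor
  · intro h
    exact ⟨fun i j hij hle => h _ _ (fun e => hij (Fin.castAdd_injective _ _ e)) ((hl i j).2 hle),
      fun i j hij hle => h _ _ (fun e => hij (Fin.natAdd_injective _ _ e)) ((hr i j).2 hle)⟩
  · rintro ⟨h₁, h₂⟩ i j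
    change Fin (P.n + Q.n) at i j
    induction i using Fin.addCases with
    | left i =>
      induction j using Fin.addCases with
      | left j => exact fun hij hle => h₁ i j (fun e => hij (e ▸ rfl)) ((hl i j).1 hle)
      | right j => exact fun _ hle => absurd hle (hlr i j)
    | right i =>
      induction j using Fin.addCases with
      | left j => exact fun _ hle => absurd hle (hrl j i)
      | right j => exact fun hij hle => h₂ i j (fun e => hij (e ▸ rfl)) ((hr i j).1 hle)

open scoped Classical in
theorem theta_of_mul (P Q : SpecialPoset) : theta K (HSP.of K (P * Q)) =
    ∑ ρ : Equiv.Perm (Fin (P.n + Q.n)) with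
      (∀ i j, i ≠ j → P.ord.le i j → ρ⁻¹ (Fin.castAdd _ i) < ρ⁻¹ (Fin.castAdd _ j)) ∧
      (∀ i j, i ≠ j → Q.ord.le i j → ρ⁻¹ (Fin.natAdd _ i) < ρ⁻¹ (Fin.natAdd _ j)), of K ρ := by
  rw [mul_eq_comp, theta_of]
  exact Finset.sum_congr (Finset.filter_congr fun ρ _ => isLinExt_comp P Q ρ) fun _ _ => rfl

theorem theta_mul_of (P Q : SpecialPoset) :
    theta K (HSP.of K (P * Q)) = theta K (HSP.of K P) * theta K (HSP.of K Q) := by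
  classical
  rw [theta_of_mul, theta_of, theta_of]
  change _ = mulBilin K _ _
  simp only [map_sum, LinearMap.sum_apply]
  have h : ∀ (σ : Equiv.Perm (Fin P.n)) (τ : Equiv.Perm (Fin Q.n)),
      mulBilin K (of K σ) (of K τ) =
        ∑ ε : Equiv.Perm (Fin (P.n + Q.n)) with IsShuffle _ _ ε, of K (tens σ τ * ε) := by
    intro σ τ
    refine (of_mul_of K σ τ).trans ?_
    rw [mulPerm]
  simp only [h]
  rw [Finset.sum_comm, ← Finset.sum_product', ← Finset.sum_product']
  have hinv : ∀ (σ : Equiv.Perm (Fin P.n)) (τ : Equiv.Perm (Fin Q.n)) ε,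
      (∀ i, (tens σ τ * ε)⁻¹ (Fin.castAdd _ i) = ε⁻¹ (Fin.castAdd _ (σ⁻¹ i))) ∧
      (∀ i, (tens σ τ * ε)⁻¹ (Fin.natAdd _ i) = ε⁻¹ (Fin.natAdd _ (τ⁻¹ i))) := by
    intro σ τ ε
    rw [mul_inv_rev, tens_inv]
    exact ⟨fun i => by rw [Equiv.Perm.mul_apply, tens_castAdd],
      fun i => by rw [Equiv.Perm.mul_apply, tens_natAdd]⟩
  have inv_app : ∀ {m : ℕ} (σ : Equiv.Perm (Fin m)) i, σ⁻¹ (σ i) = i := fun σ i => by simp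
  symm
  refine Finset.sum_bij (fun x _ => tens x.1.1 x.1.2 * x.2) ?_ ?_ ?_ ?_
  · rintro ⟨⟨σ, τ⟩, ε⟩
    simp only [Finset.mem_product, Finset.mem_filter_univ]
    rintro ⟨⟨hσ, hτ⟩, hε⟩
    refine ⟨fun i j hij hle => ?_, fun i j hij hle => ?_⟩
    · rw [(hinv σ τ ε).1, (hinv σ τ ε).1]
      exact hε.1 (hσ i j hij hle)
    · rw [(hinv σ τ ε).2, (hinv σ τ ε).2]
      exact hε.2 (hτ i j hij hle)
  · rintro ⟨⟨σ, τ⟩, ε⟩ hx ⟨⟨σ', τ'⟩, ε'⟩ hx' he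
    simp only [Finset.mem_product, Finset.mem_filter_univ] at hx hx' he
    obtain rfl : σ = σ' := by
      refine perm_unique (w := fun i => (tens σ τ * ε)⁻¹ (Fin.castAdd _ i)) ?_ ?_
      · simp only [(hinv σ τ ε).1, inv_app]
        exact hx.2.1
      · simp only [he, (hinv σ' τ' ε').1, inv_app]
        exact hx'.2.1
    obtain rfl : τ = τ' := by
      refine perm_unique (w := fun i => (tens σ τ * ε)⁻¹ (Fin.natAdd _ i)) ?_ ?_
      · simp only [(hinv σ τ ε).2, inv_app]
        exact hx.2.2
      · simp only [he, (hinv σ τ' ε').2, inv_app]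
        exact hx'.2.2
    rw [mul_left_cancel he]
  · intro ρ hρ
    simp only [Finset.mem_filter_univ] at hρ
    set w₁ : Fin P.n → Fin (P.n + Q.n) := fun i => ρ⁻¹ (Fin.castAdd _ i) with hw₁
    set w₂ : Fin Q.n → Fin (P.n + Q.n) := fun i => ρ⁻¹ (Fin.natAdd _ i) with hw₂
    have h₁ := strictMono_std (w := w₁) (ρ⁻¹.injective.comp (Fin.castAdd_injective _ _))
    have h₂ := strictMono_std (w := w₂) (ρ⁻¹.injective.comp (Fin.natAdd_injective _ _))
    refine ⟨⟨⟨(std w₁)⁻¹, (std w₂)⁻¹⟩, (tens (std w₁)⁻¹ (std w₂)⁻¹)⁻¹ * ρ⟩, ?_, ?_⟩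
    · simp only [Finset.mem_product, Finset.mem_filter_univ]
      refine ⟨⟨fun i j hij hle => ?_, fun i j hij hle => ?_⟩, ?_, ?_⟩
      · rw [← h₁.lt_iff_lt]
        simpa [w₁] using hρ.1 i j hij hle
      · rw [← h₂.lt_iff_lt]
        simpa [w₂] using hρ.2 i j hij hle
      · simpa [tens_castAdd, w₁] using h₁
      · simpa [tens_natAdd, w₂] using h₂
    · simp
  · intro _ _
    rfl

open scoped Classical in
theorem theta_sub {n : ℕ} (r : POrder (Fin n)) (S : Finset (Fin n)) {k : ℕ} (h : S.card = k) :
    theta K (HSP.of K (SpecialPoset.sub r S)) =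
      ∑ u : Fin k → Fin n with (Function.Injective u ∧ Finset.univ.image u = S ∧
        ∀ i j, i ≠ j → r.le (u i) (u j) → i < j), of K (std u) := by
  have hs : SpecialPoset.sub r S = ⟨k, r.comap (S.orderEmbOfFin h).toEmbedding⟩ := by
    rw [← SpecialPoset.std_ord ⟨k, r.comap (S.orderEmbOfFin h).toEmbedding⟩]
    exact (SpecialPoset.std_congr (S.orderIsoOfFin h) fun _ _ => Iff.rfl).symm
  rw [hs, theta_of]
  have hstd : ∀ u : Fin k → Fin n, Function.Injective u → Finset.univ.image u = S →
      (fun i => u ((std u)⁻¹ i)) = S.orderEmbOfFin h := fun u hu hi =>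
    Finset.orderEmbOfFin_unique h (fun i => by simp [← hi]) (strictMono_std hu)
  refine Finset.sum_bij (fun σ _ i => S.orderEmbOfFin h (σ i)) ?_ ?_ ?_ ?_
  · intro σ hσ
    simp only [Finset.mem_filter_univ] at hσ ⊢
    refine ⟨(S.orderEmbOfFin h).injective.comp σ.injective, ?_, fun i j hij hle => ?_⟩
    · refine Finset.coe_injective ?_
      rw [Finset.coe_image, Finset.coe_univ, Set.image_univ, ← Finset.range_orderEmbOfFin S h]
      exact σ.surjective.range_comp _
    · simpa using hσ (σ i) (σ j) (σ.injective.ne hij) hle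
  · intro σ _ τ _ he
    ext i
    exact congrArg _ ((S.orderEmbOfFin h).injective (congrFun he i))
  · intro u hu
    simp only [Finset.mem_filter_univ] at hu
    have he : ∀ i, S.orderEmbOfFin h (std u i) = u i := fun i => by
      rw [← hstd u hu.1 hu.2.1]
      simp
    refine ⟨std u, ?_, funext he⟩
    simp only [Finset.mem_filter_univ]
    intro i j hij hle
    refine hu.2.2 _ _ ((std u)⁻¹.injective.ne hij) ?_
    rw [← he, ← he]
    simpa using (show r.le (S.orderEmbOfFin h i) (S.orderEmbOfFin h j) from hle)
  · intro σ _
    congr 1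
    refine inv_injective ?_
    refine perm_unique (w := fun i => S.orderEmbOfFin h (σ i)) ?_ ?_
    · simpa using (S.orderEmbOfFin h).strictMono
    · exact strictMono_std ((S.orderEmbOfFin h).injective.comp σ.injective)

theorem mem_left {n : ℕ} (σ : Equiv.Perm (Fin n)) (k : Fin (n + 1)) (x : Fin n) :
    x ∈ Finset.univ.image (left σ k) ↔ (σ⁻¹ x : ℕ) < k := by
  simp only [Finset.mem_image, Finset.mem_univ, true_and]
  constructor
  · rintro ⟨i, rfl⟩
    simp [left]
  · intro h
    exact ⟨⟨σ⁻¹ x, h⟩, by simp [left]⟩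

theorem mem_right {n : ℕ} (σ : Equiv.Perm (Fin n)) (k : Fin (n + 1)) (x : Fin n) :
    x ∈ Finset.univ.image (right σ k) ↔ (k : ℕ) ≤ σ⁻¹ x := by
  simp only [Finset.mem_image, Finset.mem_univ, true_and]
  constructor
  · rintro ⟨i, rfl⟩
    simp [right]
  · intro h
    refine ⟨⟨(σ⁻¹ x : ℕ) - k, by omega⟩, ?_⟩
    rw [right, ← σ.eq_symm_apply]
    ext
    change (k : ℕ) + ((σ⁻¹ x : ℕ) - k) = (σ⁻¹ x : ℕ)
    omega

theorem left_injective {n : ℕ} (σ : Equiv.Perm (Fin n)) (k : Fin (n + 1)) :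
    Function.Injective (left σ k) := fun i j h => by
  simpa [left, Fin.ext_iff] using h

theorem right_injective {n : ℕ} (σ : Equiv.Perm (Fin n)) (k : Fin (n + 1)) :
    Function.Injective (right σ k) := fun i j h => by
  simpa [right, Fin.ext_iff] using h

theorem comul_theta_of (P : SpecialPoset) :
    Coalgebra.comul (theta K (HSP.of K P)) =
      TensorProduct.map (theta K) (theta K) (Coalgebra.comul (HSP.of K P)) := by
  classical
  have hc : ∀ I : Finset (Fin P.n), Iᶜ.card < P.n + 1 := fun I => by
    have := Iᶜ.card_le_univ
    rw [Fintype.card_fin] at this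
    omega
  rw [theta_of, HSP.comul_of, HSP.copr, map_sum, map_sum]
  simp only [comul_of, comulPerm, TensorProduct.map_tmul]
  rw [Finset.sum_comm, ← Finset.sum_fiberwise _ (fun I => (⟨Iᶜ.card, hc I⟩ : Fin (P.n + 1)))]
  refine Finset.sum_congr rfl fun k _ => ?_
  have h : ∀ I ∈ (Finset.univ.filter P.ord.IsIdeal).filter
      (fun I => (⟨Iᶜ.card, hc I⟩ : Fin (P.n + 1)) = k),
      theta K (HSP.of K (SpecialPoset.sub P.ord Iᶜ)) ⊗ₜ[K]
        theta K (HSP.of K (SpecialPoset.sub P.ord I)) =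
      ∑ x ∈ (Finset.univ.filter fun u : Fin k → Fin P.n =>
          Function.Injective u ∧ Finset.univ.image u = Iᶜ ∧
          ∀ i j, i ≠ j → P.ord.le (u i) (u j) → i < j) ×ˢ
        (Finset.univ.filter fun u : Fin (P.n - k) → Fin P.n =>
          Function.Injective u ∧ Finset.univ.image u = I ∧
          ∀ i j, i ≠ j → P.ord.le (u i) (u j) → i < j),
        of K (std x.1) ⊗ₜ[K] of K (std x.2) := by
    intro I hI
    have hk : Iᶜ.card = (k : ℕ) := congrArg Fin.val (Finset.mem_filter.1 hI).2
    have hk' : I.card = P.n - k := by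
      have := I.card_le_univ
      rw [Finset.card_compl] at hk
      rw [Fintype.card_fin] at hk this
      omega
    rw [theta_sub K _ _ hk, theta_sub K _ _ hk', TensorProduct.sum_tmul, Finset.sum_product]
    simp only [TensorProduct.tmul_sum]
  rw [Finset.sum_congr rfl h, Finset.sum_sigma']
  refine Finset.sum_bij
    (fun σ _ => ⟨Finset.univ.image (right σ k), (left σ k, right σ k)⟩) ?_ ?_ ?_ ?_
  · intro σ hσ
    simp only [Finset.mem_filter_univ, Finset.mem_sigma, Finset.mem_filter, Finset.mem_product,
      Finset.mem_univ, true_and] at hσ ⊢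
    have hcompl : Finset.univ.image (left σ k) = (Finset.univ.image (right σ k))ᶜ := by
      ext x
      rw [Finset.mem_compl, mem_left, mem_right, not_le]
    refine ⟨⟨?_, ?_⟩, ⟨left_injective σ k, hcompl, ?_⟩, right_injective σ k, ?_⟩
    · intro x hx y hxy
      rw [mem_right] at hx ⊢
      rcases eq_or_ne x y with rfl | hne
      · exact hx
      · exact hx.trans (hσ x y hne hxy).le
    · ext
      change (Finset.univ.image (right σ k))ᶜ.card = (k : ℕ)
      rw [← hcompl, Finset.card_image_of_injective _ (left_injective σ k), Finset.card_univ,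
        Fintype.card_fin]
    · intro i j hij hle
      have := hσ _ _ ((left_injective σ k).ne hij) hle
      simp only [left, Equiv.Perm.coe_inv, Equiv.symm_apply_apply] at this
      exact this
    · intro i j hij hle
      have := hσ _ _ ((right_injective σ k).ne hij) hle
      simp only [right, Equiv.Perm.coe_inv, Equiv.symm_apply_apply] at this
      exact Nat.lt_of_add_lt_add_left (Fin.lt_def.1 this)
  · intro σ _ τ _ he
    have h₁ : left σ k = left τ k := congrArg (fun x => x.2.1) he
    have h₂ : right σ k = right τ k := congrArg (fun x => x.2.2) he
    ext i
    rcases lt_or_ge (i : ℕ) k with hi | hi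
    · exact congrArg Fin.val (congrFun h₁ ⟨i, hi⟩)
    · have := congrFun h₂ ⟨i - k, by omega⟩
      have hk : (⟨(k : ℕ) + (i - k), by omega⟩ : Fin P.n) = i := by ext; simp; omega
      simp only [right, hk] at this
      rw [this]
  · rintro ⟨I, u, v⟩ hx
    simp only [Finset.mem_filter_univ, Finset.mem_sigma, Finset.mem_filter, Finset.mem_product,
      Finset.mem_univ, true_and] at hx
    obtain ⟨⟨hI, -⟩, ⟨hu, hui, huc⟩, hv, hvi, hvc⟩ := hx
    have hu' : ∀ i, u i ∉ I := fun i => by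
      rw [← Finset.mem_compl, ← hui]
      exact Finset.mem_image_of_mem _ (Finset.mem_univ _)
    have hv' : ∀ i, v i ∈ I := fun i => by
      rw [← hvi]
      exact Finset.mem_image_of_mem _ (Finset.mem_univ _)
    let f : Fin P.n → Fin P.n := fun i =>
      if hi : (i : ℕ) < k then u ⟨i, hi⟩ else v ⟨i - k, by omega⟩
    have hf₁ : ∀ (i : Fin P.n) (hi : (i : ℕ) < k), f i = u ⟨i, hi⟩ := fun i hi => dif_pos hi
    have hf₂ : ∀ (i : Fin P.n) (hi : ¬ (i : ℕ) < k), f i = v ⟨i - k, by omega⟩ := fun i hi => dif_neg hi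
    have hf : Function.Injective f := by
      intro i j hij
      by_cases hi : (i : ℕ) < k <;> by_cases hj : (j : ℕ) < k
      · rw [hf₁ i hi, hf₁ j hj] at hij
        simpa [Fin.ext_iff] using hu hij
      · rw [hf₁ i hi, hf₂ j hj] at hij
        exact absurd (hij ▸ hv' _) (hu' _)
      · rw [hf₂ i hi, hf₁ j hj] at hij
        exact absurd (hij ▸ hv' _) (hu' _)
      · rw [hf₂ i hi, hf₂ j hj] at hij
        have := Fin.ext_iff.1 (hv hij)
        ext
        simp only at this
        omega
    let σ : Equiv.Perm (Fin P.n) := Equiv.ofBijective f (Finite.injective_iff_bijective.1 hf)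
    have hσ : ∀ i, σ i = f i := fun _ => rfl
    have hl : left σ k = u := by
      ext i
      rw [left, hσ, hf₁ _ i.2]
    have hr : right σ k = v := by
      ext i
      have hi : ¬ (((⟨k + i, by omega⟩ : Fin P.n) : ℕ) < k) := by simp
      rw [right, hσ, hf₂ _ hi]
      simp
    refine ⟨σ, ?_, ?_⟩
    · simp only [Finset.mem_filter_univ]
      intro x y hxy hle
      obtain ⟨i, rfl⟩ := σ.surjective x
      obtain ⟨j, rfl⟩ := σ.surjective y
      simp only [Equiv.Perm.coe_inv, Equiv.symm_apply_apply]
      have hij : i ≠ j := fun e => hxy (congrArg _ e)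
      rw [hσ, hσ] at hle
      by_cases hi : (i : ℕ) < k <;> by_cases hj : (j : ℕ) < k
      · rw [hf₁ i hi, hf₁ j hj] at hle
        exact huc ⟨i, hi⟩ ⟨j, hj⟩ (fun e => hij (Fin.ext (Fin.mk.inj e))) hle
      · exact Fin.lt_def.2 (by omega)
      · rw [hf₂ i hi, hf₁ j hj] at hle
        exact absurd (hI _ (hv' _) _ hle) (hu' _)
      · rw [hf₂ i hi, hf₂ j hj] at hle
        have := hvc _ _ (fun e => hij (Fin.ext (by have := Fin.ext_iff.1 e; simp only at this; omega))) hle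
        rw [Fin.lt_def] at this ⊢
        simp only at this
        omega
    · rw [hl, hr, hvi]
  · intro σ _
    rfl

theorem theta_mul' (x y : HSP K) : theta K (x * y) = theta K x * theta K y := by
  have : (LinearMap.mul K (HSP K)).compr₂ (theta K) = (mulBilin K).compl₁₂ (theta K) (theta K) :=
    (HSP.basis K).ext fun P => (HSP.basis K).ext fun Q =>
      (congrArg (theta K) (HSP.of_mul K P Q).symm).trans (theta_mul_of K P Q)
  exact congrArg (fun f => f x y) this

theorem theta_one' : theta K 1 = 1 := by
  classical
  rw [← HSP.of_one, theta_of]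
  rw [Finset.sum_eq_single_of_mem (1 : Equiv.Perm (Fin (SpecialPoset.n 1)))]
  · rfl
  · rw [Finset.mem_filter_univ]
    exact fun i => Fin.elim0 i
  · exact fun σ _ h => absurd (Subsingleton.elim (α := Equiv.Perm (Fin 0)) σ 1) h

theorem comul_theta (x : HSP K) :
    Coalgebra.comul (theta K x) = TensorProduct.map (theta K) (theta K) (Coalgebra.comul x) := by
  have : Coalgebra.comul ∘ₗ theta K = TensorProduct.map (theta K) (theta K) ∘ₗ Coalgebra.comul :=
    (HSP.basis K).ext fun P => comul_theta_of K P
  exact congrArg (fun f => f x) this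

theorem counit_theta (x : HSP K) :
    Coalgebra.counit (R := K) (theta K x) = Coalgebra.counit (R := K) x := by
  have : Coalgebra.counit ∘ₗ theta K = Coalgebra.counit (R := K) (A := HSP K) :=
    (HSP.basis K).ext fun P => by
      classical
      change Coalgebra.counit (theta K (HSP.of K P)) = Coalgebra.counit (HSP.of K P)
      rw [HSP.counit_of]
      split_ifs with h
      · obtain rfl := HSP.eq_one_of_n h
        rw [HSP.of_one, theta_one']
        exact counit_of K 1
      · rw [theta_of, map_sum]
        exact Finset.sum_eq_zero fun σ _ => (counit_of K σ).trans (if_neg h)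
  exact congrArg (fun f => f x) this

theorem theta_surjective : Function.Surjective (theta K) := by
  classical
  rw [← LinearMap.range_eq_top, eq_top_iff, ← (basis K).span_eq, Submodule.span_le]
  rintro _ ⟨⟨n, σ⟩, rfl⟩
  refine ⟨HSP.of K ⟨n, ⟨fun i j => σ⁻¹ i ≤ σ⁻¹ j, fun _ => le_rfl, fun _ _ _ => le_trans,
    fun _ _ h h' => σ⁻¹.injective (le_antisymm h h')⟩⟩, ?_⟩
  rw [theta_of, Finset.sum_eq_single_of_mem σ]
  · simp only [Finset.mem_filter_univ]
    intro i j hij hle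
    exact lt_of_le_of_ne hle (σ⁻¹.injective.ne hij)
  · intro τ hτ hne
    simp only [Finset.mem_filter_univ] at hτ
    refine absurd (perm_unique (w := fun i => τ⁻¹ i) (σ := τ) (τ := σ) ?_ ?_) hne
    · intro i j hij
      simpa using hij
    · intro i j hij
      refine hτ _ _ (σ.injective.ne hij.ne) ?_
      change σ⁻¹ (σ i) ≤ σ⁻¹ (σ j)
      simpa using hij.le

instance : Ring (FQSym K) where
  __ := (inferInstance : AddCommGroup (FQSym K))
  left_distrib x y z := (mulBilin K x).map_add y z
  right_distrib x y z := LinearMap.congr_fun ((mulBilin K).map_add x y) z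
  zero_mul x := LinearMap.congr_fun ((mulBilin K).map_zero) x
  mul_zero x := (mulBilin K x).map_zero
  mul_assoc x y z := by
    obtain ⟨x, rfl⟩ := theta_surjective K x
    obtain ⟨y, rfl⟩ := theta_surjective K y
    obtain ⟨z, rfl⟩ := theta_surjective K z
    rw [← theta_mul', ← theta_mul', ← theta_mul', ← theta_mul', mul_assoc]
  one_mul x := by
    obtain ⟨x, rfl⟩ := theta_surjective K x
    rw [← theta_one', ← theta_mul', one_mul]
  mul_one x := by
    obtain ⟨x, rfl⟩ := theta_surjective K x
    rw [← theta_one', ← theta_mul', mul_one]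

instance : Algebra K (FQSym K) :=
  Algebra.ofModule (fun c x y => LinearMap.congr_fun ((mulBilin K).map_smul c x) y)
    (fun c x y => (mulBilin K x).map_smul c y)

instance : Coalgebra K (FQSym K) where
  coassoc := by
    refine LinearMap.ext fun x => ?_
    obtain ⟨x, rfl⟩ := theta_surjective K x
    simp only [LinearMap.comp_apply, LinearEquiv.coe_coe, comul_theta]
    rw [CoalgebraTransfer.assoc_rTensor _ (comul_theta K),
      CoalgebraTransfer.lTensor_comul _ (comul_theta K), Coalgebra.coassoc_apply]
  rTensor_counit_comp_comul := by
    refine LinearMap.ext fun x => ?_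
    obtain ⟨x, rfl⟩ := theta_surjective K x
    simp only [LinearMap.comp_apply, comul_theta]
    rw [CoalgebraTransfer.rTensor_counit _ (counit_theta K), Coalgebra.rTensor_counit_comul]
    rfl
  lTensor_counit_comp_comul := by
    refine LinearMap.ext fun x => ?_
    obtain ⟨x, rfl⟩ := theta_surjective K x
    simp only [LinearMap.comp_apply, comul_theta]
    rw [CoalgebraTransfer.lTensor_counit _ (counit_theta K), Coalgebra.lTensor_counit_comul]
    rfl

/-- The map `theta`, as a morphism of algebras. -/
def thetaAlg : HSP K →ₐ[K] FQSym K :=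
  AlgHom.ofLinearMap (theta K) (theta_one' K) (theta_mul' K)

instance : Bialgebra K (FQSym K) := Bialgebra.mk' K (FQSym K)
  (by rw [← theta_one', counit_theta, Bialgebra.counit_one])
  (by
    intro x y
    obtain ⟨x, rfl⟩ := theta_surjective K x
    obtain ⟨y, rfl⟩ := theta_surjective K y
    rw [← theta_mul', counit_theta, counit_theta, counit_theta, Bialgebra.counit_mul])
  (by
    rw [← theta_one', comul_theta, Bialgebra.comul_one]
    exact map_one (Algebra.TensorProduct.map (thetaAlg K) (thetaAlg K)))
  (by
    intro x y
    obtain ⟨x, rfl⟩ := theta_surjective K x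
    obtain ⟨y, rfl⟩ := theta_surjective K y
    rw [← theta_mul', comul_theta, comul_theta, comul_theta, Bialgebra.comul_mul]
    exact map_mul (Algebra.TensorProduct.map (thetaAlg K) (thetaAlg K)) _ _)

instance : HopfAlgebra K (FQSym K) :=
  ConnectedBialgebra.hopf (ConnectedBialgebra.isConnectedFiltration_of_span (basis K) Sigma.fst
    (basis K).span_eq
    (by
      rintro ⟨n, σ⟩ hn
      obtain rfl : n = 0 := hn
      obtain rfl : σ = 1 := Subsingleton.elim _ _
      change (1 : FQSym K) = algebraMap K _ (Coalgebra.counit 1)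
      rw [Bialgebra.counit_one, map_one])
    fun x => by
      rw [show basis K x = of K x.2 from rfl, comul_of, comulPerm]
      refine Submodule.sum_mem _ fun k _ => Submodule.subset_span ⟨_, _, ?_, rfl⟩
      change (k : ℕ) + (x.1 - k) = x.1
      omega)

end FQSym

namespace SubBialgebra

variable {K H : Type*} [Field K] [Ring H] [Bialgebra K H] (A : Subalgebra K H)

open Coalgebra

/-- The inclusion of `A ⊗ A` in `H ⊗ H`. -/
def incl : A ⊗[K] A →ₗ[K] H ⊗[K] H :=
  TensorProduct.map A.val.toLinearMap A.val.toLinearMap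

theorem incl_injective : Function.Injective (incl A) :=
  TensorProduct.map_injective_of_flat_flat _ _ Subtype.val_injective Subtype.val_injective

variable {A}

/-- The restriction of the coproduct to a subalgebra `A` such that `Δ(A) ⊆ A ⊗ A`. -/
def comul (hA : ∀ a ∈ A, Coalgebra.comul (R := K) a ∈ LinearMap.range (incl A)) :
    A →ₗ[K] A ⊗[K] A :=
  (LinearEquiv.ofInjective (incl A) (incl_injective A)).symm.toLinearMap ∘ₗ
    (Coalgebra.comul ∘ₗ A.val.toLinearMap).codRestrict _ fun a => hA a a.2

theorem incl_comul (hA : ∀ a ∈ A, Coalgebra.comul (R := K) a ∈ LinearMap.range (incl A)) (a : A) :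
    incl A (comul hA a) = Coalgebra.comul (a : H) :=
  congrArg Subtype.val ((LinearEquiv.ofInjective (incl A) (incl_injective A)).apply_symm_apply _)

/-- A subalgebra `A` such that `Δ(A) ⊆ A ⊗ A` is a bialgebra. -/
@[reducible]
def coalgebra (hA : ∀ a ∈ A, Coalgebra.comul (R := K) a ∈ LinearMap.range (incl A)) :
    Coalgebra K A :=
  letI : CoalgebraStruct K A := ⟨comul hA, counit ∘ₗ A.val.toLinearMap⟩
  have h₁ : ∀ x : A, Coalgebra.comul (A.val.toLinearMap x) =
      TensorProduct.map A.val.toLinearMap A.val.toLinearMap (Coalgebra.comul x) :=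
    fun x => (incl_comul hA x).symm
  have h₂ : ∀ x : A, Coalgebra.counit (A.val.toLinearMap x) = Coalgebra.counit (R := K) x :=
    fun _ => rfl
  { coassoc := by
      refine LinearMap.ext fun x => ?_
      have hinj : Function.Injective (TensorProduct.map A.val.toLinearMap (incl A)) :=
        TensorProduct.map_injective_of_flat_flat _ _ Subtype.val_injective (incl_injective A)
      refine hinj ?_
      have e₁ := CoalgebraTransfer.assoc_rTensor _ h₁ (Coalgebra.comul x)
      have e₂ := CoalgebraTransfer.lTensor_comul _ h₁ (Coalgebra.comul x)
      refine e₁.symm.trans (Eq.trans ?_ e₂)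
      rw [← h₁, Coalgebra.coassoc_apply]
    rTensor_counit_comp_comul := by
      refine LinearMap.ext fun x => ?_
      have hinj : Function.Injective (A.val.toLinearMap.lTensor K) :=
        Module.Flat.lTensor_preserves_injective_linearMap _ Subtype.val_injective
      refine hinj ?_
      refine (CoalgebraTransfer.rTensor_counit _ h₂ (Coalgebra.comul x)).symm.trans ?_
      rw [← h₁, Coalgebra.rTensor_counit_comul]
      rfl
    lTensor_counit_comp_comul := by
      refine LinearMap.ext fun x => ?_
      have hinj : Function.Injective (A.val.toLinearMap.rTensor K) :=
        Module.Flat.rTensor_preserves_injective_linearMap _ Subtype.val_injective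
      refine hinj ?_
      refine (CoalgebraTransfer.lTensor_counit _ h₂ (Coalgebra.comul x)).symm.trans ?_
      rw [← h₁, Coalgebra.lTensor_counit_comul]
      rfl }

/-- A subalgebra `A` such that `Δ(A) ⊆ A ⊗ A` is a bialgebra. -/
@[reducible]
def bialgebra (hA : ∀ a ∈ A, Coalgebra.comul (R := K) a ∈ LinearMap.range (incl A)) :
    Bialgebra K A :=
  letI := coalgebra hA
  have hincl : ∀ s t : A ⊗[K] A, incl A (s * t) = incl A s * incl A t :=
    map_mul (Algebra.TensorProduct.map A.val A.val)
  Bialgebra.mk' K A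
    (Bialgebra.counit_one (R := K) (A := H))
    (fun {a b} => Bialgebra.counit_mul (R := K) (a : H) b)
    (incl_injective A <| (incl_comul hA 1).trans <| Bialgebra.comul_one.trans
      (map_one (Algebra.TensorProduct.map A.val A.val)).symm)
    (fun {a b} => incl_injective A <| by
      rw [hincl]
      refine (incl_comul hA (a * b)).trans ?_
      refine Eq.trans ?_ (congrArg₂ _ (incl_comul hA a) (incl_comul hA b)).symm
      exact Bialgebra.comul_mul (R := K) (a : H) b)

end SubBialgebra

namespace POrder

/-- The pair of orders `(h, r)` is a plane poset: two distinct elements are comparable for `h` if,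
and only if, they are not comparable for `r`. -/
def IsPlane {α : Type*} (h r : POrder α) : Prop :=
  ∀ x y, x ≠ y → ((h.le x y ∨ h.le y x) ↔ ¬ (r.le x y ∨ r.le y x))

/-- The double poset with first order `h`, and with the second order given by the linear order
of `α`, is a special plane poset: it comes from a plane poset `(h, r)`, the second order being the
induced total order (`x ≤ y` if, and only if, `x ≤ y` for `h` or for `r`). -/
def IsSpecialPlane {α : Type*} [LinearOrder α] (h : POrder α) : Prop :=
  ∃ r : POrder α, IsPlane h r ∧ ∀ x y, x ≤ y ↔ (h.le x y ∨ r.le x y)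

theorem IsSpecialPlane.comap {α β : Type*} [LinearOrder α] [LinearOrder β] {h : POrder β}
    (hh : h.IsSpecialPlane) (f : α ↪o β) : (h.comap f.toEmbedding).IsSpecialPlane := by
  obtain ⟨r, h₁, h₂⟩ := hh
  refine ⟨r.comap f.toEmbedding, fun x y hxy => h₁ _ _ (f.injective.ne hxy), fun x y => ?_⟩
  rw [← f.le_iff_le]
  exact h₂ _ _

/-- The sum of two orders, where every element of `α` is smaller than every element of `β`. -/
def lexSum {α β : Type*} (r : POrder α) (s : POrder β) : POrder (α ⊕ₗ β) where
  le x y := match ofLex x, ofLex y with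
    | .inl a, .inl b => r.le a b
    | .inr a, .inr b => s.le a b
    | .inl _, .inr _ => True
    | .inr _, .inl _ => False
  refl x := by
    rcases x with a | a
    exacts [r.refl a, s.refl a]
  trans x y z := by
    rcases x with a | a <;> rcases y with b | b <;> rcases z with c | c <;>
      first
      | exact r.trans a b c
      | exact s.trans a b c
      | exact fun _ _ => trivial
      | exact fun h _ => False.elim h
      | exact fun _ h => False.elim h
  antisymm x y := by
    rcases x with a | a <;> rcases y with b | b
    exacts [fun h h' => congrArg Sum.inl (r.antisymm _ _ h h'), fun _ h => False.elim h,
      fun h => False.elim h, fun h h' => congrArg Sum.inr (s.antisymm _ _ h h')]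

theorem IsSpecialPlane.sum {α β : Type*} [LinearOrder α] [LinearOrder β] {h : POrder α}
    {h' : POrder β} (hh : h.IsSpecialPlane) (hh' : h'.IsSpecialPlane) :
    (h.sum h').IsSpecialPlane := by
  obtain ⟨r, h₁, h₂⟩ := hh
  obtain ⟨r', h₁', h₂'⟩ := hh'
  refine ⟨r.lexSum r', ?_, ?_⟩
  · simp only [IsPlane, HSP.lex_forall]
    refine ⟨fun a => ⟨fun b hab => h₁ a b fun e => hab (e ▸ rfl), fun b _ => ?_⟩,
      fun a => ⟨fun b _ => ?_, fun b hab => h₁' a b fun e => hab (e ▸ rfl)⟩⟩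
    · exact iff_of_false (fun h => h.elim id id) (fun h => h (Or.inl trivial))
    · exact iff_of_false (fun h => h.elim id id) (fun h => h (Or.inr trivial))
  · simp only [HSP.lex_forall]
    refine ⟨fun a => ⟨fun b => Sum.Lex.inl_le_inl_iff.trans (h₂ a b), fun b => ?_⟩,
      fun a => ⟨fun b => ?_, fun b => Sum.Lex.inr_le_inr_iff.trans (h₂' a b)⟩⟩
    · exact iff_of_true (Sum.Lex.inl_le_inr _ _) (Or.inr trivial)
    · exact iff_of_false Sum.Lex.not_inr_le_inl (fun h => h.elim id id)

end POrder

namespace SpecialPoset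

theorem isSpecialPlane_std {α : Type*} [Fintype α] [LinearOrder α] {r : POrder α}
    (h : r.IsSpecialPlane) : (std r).ord.IsSpecialPlane :=
  h.comap (monoEquivOfFin α rfl).toOrderEmbedding

theorem isSpecialPlane_sub {α : Type*} [LinearOrder α] {r : POrder α} (h : r.IsSpecialPlane)
    (S : Finset α) : (sub r S).ord.IsSpecialPlane :=
  have : (r.res S).IsSpecialPlane := by
    obtain ⟨q, h₁, h₂⟩ := h
    exact ⟨q.res S, fun x y hxy => h₁ x y fun e => hxy (Subtype.ext e), fun x y => h₂ x y⟩
  isSpecialPlane_std this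

theorem isSpecialPlane_mul {P Q : SpecialPoset} (hP : P.ord.IsSpecialPlane)
    (hQ : Q.ord.IsSpecialPlane) : (P * Q).ord.IsSpecialPlane :=
  isSpecialPlane_std (hP.sum hQ)

theorem isSpecialPlane_one : (1 : SpecialPoset).ord.IsSpecialPlane :=
  ⟨(1 : SpecialPoset).ord, fun x => Fin.elim0 x, fun x => Fin.elim0 x⟩

end SpecialPoset

namespace HSP

variable (K : Type*) [Field K]

/-- The subspace of `HSP K` spanned by the special plane posets (it is a subalgebra). -/
def spp : Subalgebra K (HSP K) :=
  (Submodule.span K {x | ∃ P : SpecialPoset, P.ord.IsSpecialPlane ∧ x = of K P}).toSubalgebra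
    (Submodule.subset_span ⟨1, SpecialPoset.isSpecialPlane_one, (of_one K).symm⟩)
    (by
      intro x y hx hy
      induction hx, hy using Submodule.span_induction₂ with
      | mem_mem x y hx hy =>
        obtain ⟨P, hP, rfl⟩ := hx
        obtain ⟨Q, hQ, rfl⟩ := hy
        exact Submodule.subset_span ⟨P * Q, SpecialPoset.isSpecialPlane_mul hP hQ, of_mul K P Q |>.symm⟩
      | zero_left y hy => rw [zero_mul]; exact zero_mem _
      | zero_right x hx => rw [mul_zero]; exact zero_mem _
      | add_left x y z _ _ _ h₁ h₂ => rw [add_mul]; exact add_mem h₁ h₂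
      | add_right x y z _ _ _ h₁ h₂ => rw [mul_add]; exact add_mem h₁ h₂
      | smul_left c x y _ _ h => rw [smul_mul_assoc]; exact Submodule.smul_mem _ _ h
      | smul_right c x y _ _ h => rw [mul_smul_comm]; exact Submodule.smul_mem _ _ h)

/-- A special plane poset, as an element of `spp K`. -/
def ofSpp (P : {P : SpecialPoset // P.ord.IsSpecialPlane}) : spp K :=
  ⟨of K P, Submodule.subset_span ⟨P, P.2, rfl⟩⟩

theorem comul_ofSpp (P : {P : SpecialPoset // P.ord.IsSpecialPlane}) :
    Coalgebra.comul (of K P.1) ∈ Submodule.map (SubBialgebra.incl (spp K))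
      (Submodule.span K {t | ∃ Q R : {P : SpecialPoset // P.ord.IsSpecialPlane},
        Q.1.n + R.1.n = P.1.n ∧ t = ofSpp K Q ⊗ₜ[K] ofSpp K R}) := by
  rw [comul_of K P.1, copr]
  refine Submodule.sum_mem _ fun I _ => ⟨_, Submodule.subset_span
    ⟨⟨_, SpecialPoset.isSpecialPlane_sub P.2 Iᶜ⟩, ⟨_, SpecialPoset.isSpecialPlane_sub P.2 I⟩, ?_,
      rfl⟩, rfl⟩
  rw [n_sub, n_sub, Finset.card_compl_add_card, Fintype.card_fin]

theorem span_ofSpp : Submodule.span K (Set.range (ofSpp K)) = ⊤ := by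
  refine Submodule.map_injective_of_injective (f := (spp K).val.toLinearMap)
    Subtype.val_injective ?_
  rw [Submodule.map_span, Submodule.map_top]
  refine le_antisymm (Submodule.span_le.2 ?_) ?_
  · rintro _ ⟨_, ⟨P, rfl⟩, rfl⟩
    exact ⟨_, rfl⟩
  · rintro _ ⟨⟨x, hx⟩, rfl⟩
    refine Submodule.span_mono ?_ (show x ∈ Submodule.span K
      {x | ∃ P : SpecialPoset, P.ord.IsSpecialPlane ∧ x = of K P} from hx)
    rintro _ ⟨P, hP, rfl⟩
    exact ⟨_, ⟨⟨P, hP⟩, rfl⟩, rfl⟩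

theorem comul_mem_spp (x : HSP K) (hx : x ∈ spp K) :
    Coalgebra.comul (R := K) x ∈ LinearMap.range (SubBialgebra.incl (spp K)) := by
  replace hx : x ∈ Submodule.span K {x | ∃ P : SpecialPoset, P.ord.IsSpecialPlane ∧ x = of K P} :=
    hx
  induction hx using Submodule.span_induction with
  | mem x hx =>
    obtain ⟨P, hP, rfl⟩ := hx
    exact LinearMap.map_le_range (comul_ofSpp K ⟨P, hP⟩)
  | zero => simp
  | add x y _ _ hx hy => rw [map_add]; exact add_mem hx hy
  | smul c x _ hx => rw [map_smul]; exact Submodule.smul_mem _ _ hx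

instance : Bialgebra K (spp K) := SubBialgebra.bialgebra (comul_mem_spp K)

instance : HopfAlgebra K (spp K) :=
  ConnectedBialgebra.hopf (ConnectedBialgebra.isConnectedFiltration_of_span (ofSpp K)
    (fun P => P.1.n)
    (span_ofSpp K)
    (by
      rintro ⟨P, h⟩ hP
      obtain rfl : P = 1 := eq_one_of_n hP
      have : ofSpp K ⟨1, h⟩ = 1 := Subtype.ext (of_one K)
      rw [this, Bialgebra.counit_one, map_one])
    fun P => by
      obtain ⟨t, ht, h⟩ := comul_ofSpp K P
      have : Coalgebra.comul (ofSpp K P) = t :=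
        SubBialgebra.incl_injective _ ((SubBialgebra.incl_comul (comul_mem_spp K) _).trans h.symm)
      rwa [this])

end HSP

end

/-!
Why `theta` is bijective on special plane posets.

A special plane poset on `{0, ..., n - 1}` is a transitive set of pairs `i < j` whose complement is
transitive as well, that is, the set of non-inversions of a permutation: the special plane posets
are exactly the posets `nonInv σ` with `i ≤ j` and `σ⁻¹ i ≤ σ⁻¹ j`
(`POrder.isSpecialPlane_nonInv`, `POrder.IsSpecialPlane.exists_eq_nonInv`).
A permutation `τ` is a linear extension of `nonInv σ` exactly when each inversion of `τ` is an
inversion of `σ` (the weak order), so that `theta` sends `nonInv σ` to `σ` plus permutations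
with strictly fewer inversions (`FQSym.theta_planeOf`). The composition of `σ ↦ nonInv σ` with
`theta` is thus unitriangular in the basis of permutations, and is bijective
(`bijective_of_unitriangular`); as `σ ↦ nonInv σ` hits all special plane posets, the
restriction of `theta` to their span is bijective. The compatibility with the products and the
coproducts is that of `theta` on all special posets.
-/

open scoped TensorProduct

noncomputable section

/-! ### Special plane posets and permutations -/

namespace POrder

/-- The first order of the special plane poset attached to a permutation `σ`: two letters `i ≤ j`
are comparable when they do not form an inversion, that is, when `i` comes before `j` in the word
representing `σ`. -/
def nonInv {n : ℕ} (σ : Equiv.Perm (Fin n)) : POrder (Fin n) where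
  le i j := i ≤ j ∧ σ⁻¹ i ≤ σ⁻¹ j
  refl _ := ⟨le_rfl, le_rfl⟩
  trans _ _ _ h h' := ⟨h.1.trans h'.1, h.2.trans h'.2⟩
  antisymm _ _ h h' := le_antisymm h.1 h'.1

theorem isSpecialPlane_nonInv {n : ℕ} (σ : Equiv.Perm (Fin n)) : (nonInv σ).IsSpecialPlane := by
  -- The inversions of `σ` form the complementary order.
  refine ⟨⟨fun i j => i ≤ j ∧ σ⁻¹ j ≤ σ⁻¹ i, fun _ => ⟨le_rfl, le_rfl⟩,
    fun _ _ _ h h' => ⟨h.1.trans h'.1, h'.2.trans h.2⟩, fun _ _ h h' => le_antisymm h.1 h'.1⟩,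
    fun x y hxy => ?_, fun x y => ?_⟩
  · have hσ : σ⁻¹ x ≠ σ⁻¹ y := σ⁻¹.injective.ne hxy
    simp only [nonInv]
    generalize σ⁻¹ x = a at *
    generalize σ⁻¹ y = b at *
    omega
  · exact ⟨fun h => (le_total (σ⁻¹ x) (σ⁻¹ y)).imp (fun h' => ⟨h, h'⟩) fun h' => ⟨h, h'⟩,
      fun h => h.elim And.left And.left⟩

/-- A total order on a set with `n` elements is the order in which some bijection with
`{0, ..., n - 1}` enumerates this set. -/
theorem exists_equiv_of_total {α : Type*} [Fintype α] {n : ℕ} (hn : Fintype.card α = n)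
    (t : POrder α) (ht : ∀ x y, t.le x y ∨ t.le y x) :
    ∃ e : Fin n ≃ α, ∀ x y, e.symm x ≤ e.symm y ↔ t.le x y := by
  classical
  let L : LinearOrder α :=
    { le := t.le
      le_refl := t.refl
      le_trans := t.trans
      le_antisymm := t.antisymm
      le_total := ht
      toDecidableLE := Classical.decRel _ }
  exact ⟨(monoEquivOfFin α hn).toEquiv, fun x y => (monoEquivOfFin α hn).symm.le_iff_le⟩

/-- Every special plane poset comes from a permutation: the first order and the opposite of the
complementary order form together a total order, the one in which the word of the permutation
lists the letters. -/
theorem IsSpecialPlane.exists_eq_nonInv {n : ℕ} {h : POrder (Fin n)} (hh : h.IsSpecialPlane) :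
    ∃ σ : Equiv.Perm (Fin n), h = nonInv σ := by
  obtain ⟨r, h₁, h₂⟩ := hh
  have excl : ∀ x y, h.le x y → r.le x y → x = y := fun x y hx hr =>
    by_contra fun hxy => (h₁ x y hxy).1 (Or.inl hx) (Or.inl hr)
  have total : ∀ x y, (h.le x y ∨ r.le y x) ∨ h.le y x ∨ r.le x y := fun x y => by
    have := (le_total x y).imp (h₂ x y).1 (h₂ y x).1
    tauto
  -- The two remaining ways to compare `x` with `z` give, by transitivity, a pair comparable for
  -- both orders, whose two elements have to be equal.
  have trans : ∀ x y z, h.le x y → r.le z y → h.le x z ∨ r.le z x := by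
    intro x y z hxy hzy
    rcases total x z with hxz | hzx | hxz
    · exact hxz
    · obtain rfl := excl z y (h.trans _ _ _ hzx hxy) hzy
      exact Or.inl hxy
    · obtain rfl := excl x y hxy (r.trans _ _ _ hxz hzy)
      exact Or.inr hzy
  have trans' : ∀ x y z, r.le y x → h.le y z → h.le x z ∨ r.le z x := by
    intro x y z hyx hyz
    rcases total x z with hxz | hzx | hxz
    · exact hxz
    · obtain rfl := excl y x (h.trans _ _ _ hyz hzx) hyx
      exact Or.inl hyz
    · obtain rfl := excl y z hyz (r.trans _ _ _ hyx hxz)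
      exact Or.inr hyx
  let t : POrder (Fin n) :=
    { le := fun x y => h.le x y ∨ r.le y x
      refl := fun x => Or.inl (h.refl x)
      trans := by
        rintro x y z (hxy | hxy) (hyz | hyz)
        · exact Or.inl (h.trans _ _ _ hxy hyz)
        · exact trans x y z hxy hyz
        · exact trans' x y z hxy hyz
        · exact Or.inr (r.trans _ _ _ hyz hxy)
      antisymm := by
        rintro x y (hxy | hxy) (hyx | hyx)
        · exact h.antisymm _ _ hxy hyx
        · exact excl x y hxy hyx
        · exact (excl y x hyx hxy).symm
        · exact r.antisymm _ _ hyx hxy }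
  obtain ⟨σ, hσ⟩ := exists_equiv_of_total (Fintype.card_fin n) t total
  refine ⟨σ, POrder.ext (funext fun x => funext fun y => propext ?_)⟩
  refine ⟨fun hxy => ⟨(h₂ x y).2 (Or.inl hxy), (hσ x y).2 (Or.inl hxy)⟩, fun ⟨hxy, h'⟩ => ?_⟩
  rcases (hσ x y).1 h' with H | H
  · exact H
  · rw [le_antisymm hxy ((h₂ y x).2 (Or.inr H))]
    exact h.refl _

end POrder

/-! ### Unitriangular maps -/

/-- An endomorphism that is unitriangular for a basis, with respect to a grading of the basis by
natural numbers, is bijective. -/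
theorem bijective_of_unitriangular {K M ι : Type*} [Field K] [AddCommGroup M] [Module K M]
    (b : Module.Basis ι K M) (deg : ι → ℕ) (f : M →ₗ[K] M)
    (hf : ∀ i, f (b i) - b i ∈ Submodule.span K (b '' {j | deg j < deg i})) :
    Function.Bijective f := by
  classical
  constructor
  · rw [← LinearMap.ker_eq_bot, LinearMap.ker_eq_bot']
    intro x hx
    by_contra hne
    have hs : (b.repr x).support.Nonempty := by
      simpa [Finsupp.support_nonempty_iff] using hne
    -- A basis vector of maximal degree in `x` keeps its coefficient in `f x`.
    obtain ⟨i, hi, hmax⟩ := Finset.exists_max_image _ deg hs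
    have hcoeff : ∀ j ∈ (b.repr x).support, b.repr (f (b j) - b j) i = 0 := by
      intro j hj
      have := b.mem_span_image.1 (hf j)
      by_contra h
      have := this (Finsupp.mem_support_iff.2 h)
      exact absurd (hmax j hj) (not_le.2 this)
    have hsum : f x - x = ∑ j ∈ (b.repr x).support, b.repr x j • (f (b j) - b j) := by
      conv_lhs => rw [← b.linearCombination_repr x, Finsupp.linearCombination_apply, Finsupp.sum]
      simp [map_sum, smul_sub]
    have h0 : b.repr (f x - x) i = 0 := by
      rw [hsum, map_sum, Finsupp.finsetSum_apply]
      refine Finset.sum_eq_zero fun j hj => ?_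
      rw [map_smul, Finsupp.smul_apply, hcoeff j hj, smul_zero]
    rw [hx, zero_sub, map_neg, Finsupp.neg_apply, neg_eq_zero] at h0
    exact Finsupp.mem_support_iff.1 hi h0
  · rw [← LinearMap.range_eq_top, eq_top_iff, ← b.span_eq, Submodule.span_le]
    have key : ∀ m i, deg i = m → b i ∈ LinearMap.range f := by
      intro m
      induction m using Nat.strong_induction_on with
      | _ m ih =>
        rintro i rfl
        have : f (b i) - b i ∈ LinearMap.range f := by
          refine Submodule.span_le.2 ?_ (hf i)
          rintro _ ⟨j, hj, rfl⟩
          exact ih _ hj j rfl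
        simpa using sub_mem (LinearMap.mem_range_self f (b i)) this
    rintro _ ⟨i, rfl⟩
    exact key _ i rfl

/-! ### The restriction of `theta` to special plane posets -/

namespace FQSym

open HSP

/-- The inversions of the permutations, in terms of letters: the pairs `i < j` of letters such that
`j` comes before `i` in the word representing `σ`. -/
def inv {n : ℕ} (σ : Equiv.Perm (Fin n)) : Finset (Fin n × Fin n) :=
  {p | p.1 < p.2 ∧ σ⁻¹ p.2 < σ⁻¹ p.1}

theorem mem_inv {n : ℕ} {σ : Equiv.Perm (Fin n)} {i j : Fin n} :
    (i, j) ∈ inv σ ↔ i < j ∧ σ⁻¹ j < σ⁻¹ i := by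
  simp [inv]

theorem inv_injective {n : ℕ} : Function.Injective (inv (n := n)) := by
  intro σ τ h
  refine perm_unique (w := fun i => τ⁻¹ i) (fun a b hab => ?_) fun a b hab => by simpa using hab
  have ha : σ⁻¹ (σ a) = a := by simp
  have hb : σ⁻¹ (σ b) = b := by simp
  have h₁ := Finset.ext_iff.1 h (σ a, σ b)
  have h₂ := Finset.ext_iff.1 h (σ b, σ a)
  rw [mem_inv, mem_inv, ha, hb] at h₁ h₂
  have hne : σ a ≠ σ b := σ.injective.ne hab.ne
  have hne' : τ⁻¹ (σ a) ≠ τ⁻¹ (σ b) := τ⁻¹.injective.ne hne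
  change τ⁻¹ (σ a) < τ⁻¹ (σ b)
  generalize τ⁻¹ (σ a) = x at *
  generalize τ⁻¹ (σ b) = y at *
  omega

/-- The linear extensions of the plane poset of `σ` are the permutations below `σ` in the weak
order. -/
theorem isLinExt_nonInv {n : ℕ} (σ τ : Equiv.Perm (Fin n)) :
    IsLinExt ⟨n, POrder.nonInv σ⟩ τ ↔ inv τ ⊆ inv σ := by
  constructor
  · rintro h ⟨i, j⟩ hij
    rw [mem_inv] at hij ⊢
    refine ⟨hij.1, lt_of_not_ge fun hle => ?_⟩
    exact lt_asymm (h i j hij.1.ne ⟨hij.1.le, hle⟩) hij.2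
  · rintro h i j hij ⟨hle, hle'⟩
    refine lt_of_not_ge fun hge => ?_
    have := h (mem_inv.2 ⟨lt_of_le_of_ne hle hij, lt_of_le_of_ne hge (τ⁻¹.injective.ne hij.symm)⟩)
    exact absurd hle' (not_le.2 (mem_inv.1 this).2)

variable (K : Type*) [Field K]

/-- The linear map that sends a permutation to its special plane poset. -/
def planeOf : FQSym K →ₗ[K] spp K :=
  (basis K).constr K fun x => ofSpp K ⟨⟨x.1, POrder.nonInv x.2⟩, POrder.isSpecialPlane_nonInv x.2⟩

theorem planeOf_basis (x : Σ n : ℕ, Equiv.Perm (Fin n)) : planeOf K (basis K x) =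
    ofSpp K ⟨⟨x.1, POrder.nonInv x.2⟩, POrder.isSpecialPlane_nonInv x.2⟩ :=
  (basis K).constr_basis K _ _

theorem planeOf_surjective : Function.Surjective (planeOf K) := by
  rw [← LinearMap.range_eq_top, eq_top_iff, ← span_ofSpp, Submodule.span_le]
  rintro _ ⟨⟨⟨n, h⟩, hP⟩, rfl⟩
  obtain ⟨σ, hσ⟩ := POrder.IsSpecialPlane.exists_eq_nonInv (n := n) (h := h) hP
  subst hσ
  exact ⟨of K σ, planeOf_basis K ⟨n, σ⟩⟩

/-- The leading term of `theta` at the plane poset of a permutation is this permutation, the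
others having fewer inversions. -/
theorem theta_planeOf (x : Σ n : ℕ, Equiv.Perm (Fin n)) :
    theta K (planeOf K (basis K x) : HSP K) - basis K x ∈
      Submodule.span K (basis K '' {y | (inv y.2).card < (inv x.2).card}) := by
  classical
  obtain ⟨n, σ⟩ := x
  rw [planeOf_basis]
  change theta K (HSP.of K ⟨n, POrder.nonInv σ⟩) - of K σ ∈ _
  have hσ : σ ∈ Finset.univ.filter (IsLinExt ⟨n, POrder.nonInv σ⟩) :=
    Finset.mem_filter.2 ⟨Finset.mem_univ _, (isLinExt_nonInv σ σ).2 subset_rfl⟩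
  rw [theta_of, ← Finset.add_sum_erase _ _ hσ, add_sub_cancel_left]
  refine Submodule.sum_mem _ fun τ hτ => Submodule.subset_span ⟨⟨n, τ⟩, ?_, rfl⟩
  obtain ⟨hne, hτ⟩ := Finset.mem_erase.1 hτ
  have hsub := (isLinExt_nonInv σ τ).1 (Finset.mem_filter.1 hτ).2
  exact Finset.card_lt_card (hsub.ssubset_of_ne fun h => hne (inv_injective h))

theorem theta_spp_bijective : Function.Bijective (theta K ∘ₗ (spp K).val.toLinearMap) := by
  have h := bijective_of_unitriangular (basis K) (fun x => (inv x.2).card)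
    ((theta K ∘ₗ (spp K).val.toLinearMap) ∘ₗ planeOf K) (theta_planeOf K)
  rw [LinearMap.coe_comp] at h
  exact ⟨h.1.of_comp_right (planeOf_surjective K), h.2.of_comp⟩

/-- The restriction of `theta` to `spp K`, as a morphism of bialgebras. -/
def thetaSpp : spp K →ₐc[K] FQSym K :=
  BialgHom.ofAlgHom ((thetaAlg K).comp (spp K).val)
    (AlgHom.ext fun x => counit_theta K x)
    (AlgHom.ext fun x => by
      have h : TensorProduct.map (theta K) (theta K) (SubBialgebra.incl (spp K) (Coalgebra.comul x)) =
          Coalgebra.comul (theta K (x : HSP K)) := by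
        rw [comul_theta]
        exact congrArg _ (SubBialgebra.incl_comul (comul_mem_spp K) x)
      rw [SubBialgebra.incl, ← LinearMap.comp_apply, ← TensorProduct.map_comp] at h
      exact h)

end FQSym

end

theorem corollary22 (K : Type*) [Field K] :
    ∃ e : HSP.spp K ≃ₐc[K] FQSym K, ∀ x : HSP.spp K, e x = FQSym.theta K (x : HSP K) := by
  exact ⟨BialgEquiv.ofBijective (FQSym.thetaSpp K) (FQSym.theta_spp_bijective K), fun _ => rfl⟩
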